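/- Let $-1<q<1$. For a complex Hilbert space $\mathcal H$, let $\Gamma_q(\mathcal H)$ be the $q$-deformed Fock space: the (separated) completion of the linear span of the elementary tensors $f_1\otimes\cdots\otimes f_n$, $f_j\in\mathcal H$, $n\ge 0$ (for $n=0$ this is the vacuum vector $\zeta_q$), with respect to the inner product $$\langle f_1\otimes\cdots\otimes f_m,\;g_1\otimes\cdots\otimes g_n\rangle_q=\delta_{m,n}\sum_{\pi\in\mathbb P_n}q^{i(\pi)}\langle f_1,g_{\pi(1)}\rangle\cdots\langle f_n,g_{\pi(n)}\rangle ,$$ where $\mathbb P_n$ is the symmetric group and $i(\pi)$ is the number of inversions of $\pi$. For $f\in\mathcal H$, the creator $l^\dagger(f)$ and the annihilator $l(f)$ are the bounded, mutually adjoint operators on $\Gamma_q(\mathcal H)$ with $$l^\dagger(f)\,f_1\otimes\cdots\otimes f_n=f\otimes f_1\otimes\cdots\otimes f_n,\qquad l(f)\,f_1\otimes\cdots\otimes f_n=\sum_{k=1}^n q^{k-1}\langle f_k,f\rangle\, f_1\otimes\cdots\otimes f_{k-1}\otimes f_{k+1}\otimes\cdots\otimes f_n$$ (inner products linear in the first argument),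 so that $l^\dagger(f)\zeta_q=f$ and $l(f)\zeta_q=0$. Take $\mathcal H=\ell^2(\mathbb Z)$ with canonical orthonormal basis $(e_j)_{j\in\mathbb Z}$, and put $l_j=l(e_j)$, $s_j=l_j+l_j^\dagger$ with $l_j^\dagger=l^\dagger(e_j)$. Let $\mathfrak R_q$ and $\mathfrak S_q$ be the unital $C^*$-algebras of operators on $\Gamma_q(\ell^2(\mathbb Z))$ generated by $\{l_j : j\in\mathbb Z\}$ and by $\{s_j : j\in\mathbb Z\}$, respectively. Let $\omega_q=\langle\,\cdot\,\zeta_q,\zeta_q\rangle$ be the Fock vacuum vector state, on either algebra. Let $M$ be one of the following monoids of maps $\mathbb Z\to\mathbb Z$ under composition: the group $\mathbb P_{\mathbb Z}$ of finite permutations (bijections moving only finitely many integers), the monoid $\mathbb L_{\mathbb Z}$ of strictly increasing maps, or the group $\mathbb Z$ of shifts $k\mapsto k+n$. Then $M$ acts on $\mathfrak R_q$ and on $\mathfrak S_q$ by unital $*$-endomorphisms $\Gamma_g$, $g\in M$, with $\Gamma_g(l_j)=l_{g(j)}$ on $\mathfrak R_q$ and $\Gamma_g(s_j)=s_{g(j)}$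 on $\mathfrak S_q$ for all $j\in\mathbb Z$ (these actions are unique). For $\mathfrak A\in\{\mathfrak R_q,\mathfrak S_q\}$ let $\mathcal S_M(\mathfrak A)$ be the set of the states $\varphi$ of $\mathfrak A$ with $\varphi\circ\Gamma_g=\varphi$ for all $g\in M$; these states are called symmetric, spreading-invariant and shift-invariant for $M=\mathbb P_{\mathbb Z},\mathbb L_{\mathbb Z},\mathbb Z$, respectively. Then $$\mathcal S_{\mathbb P_{\mathbb Z}}(\mathfrak R_q)=\mathcal S_{\mathbb L_{\mathbb Z}}(\mathfrak R_q)=\mathcal S_{\mathbb Z}(\mathfrak R_q)=\{\omega_q\}$$ and $$\mathcal S_{\mathbb P_{\mathbb Z}}(\mathfrak S_q)=\mathcal S_{\mathbb L_{\mathbb Z}}(\mathfrak S_q)=\mathcal S_{\mathbb Z}(\mathfrak S_q)=\{\omega_q\}.$$ -/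

import Mathlib

noncomputable section
namespace QFock
open scoped ComplexOrder

/-- The number of inversions of a permutation. -/
def inversions {n : ℕ} (π : Equiv.Perm (Fin n)) : ℕ :=
  (Finset.univ.filter fun p : Fin n × Fin n => p.1 < p.2 ∧ π p.2 < π p.1).card

section Positivity

theorem posSemidef_inner {ι E : Type*} [NormedAddCommGroup E] [InnerProductSpace ℂ E]
    (φ : ι → E) : (Matrix.of fun i j => inner ℂ (φ i) (φ j)).PosSemidef := by
  refine ⟨by ext i j; simp [Matrix.conjTranspose_apply], fun x => ?_⟩
  have : (x.sum fun i a => x.sum fun j b =>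
      star a * (Matrix.of fun i j => inner ℂ (φ i) (φ j)) i j * b)
      = inner ℂ (x.sum fun i a => a • φ i) (x.sum fun i a => a • φ i) := by
    simp only [Finsupp.sum, sum_inner, inner_sum, inner_smul_left, inner_smul_right,
      Matrix.of_apply]
    rw [Finset.sum_comm]
    refine Finset.sum_congr rfl fun i _ => ?_
    rw [Finset.mul_sum]
    refine Finset.sum_congr rfl fun j _ => ?_
    simp only [RCLike.star_def]; ring
  rw [this, inner_self_eq_norm_sq_to_K, ← RCLike.ofReal_pow]
  exact RCLike.ofReal_nonneg.mpr (by positivity)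

theorem posSemidef_prod {ι κ : Type*} (s : Finset κ) (A : κ → Matrix ι ι ℂ)
    (hA : ∀ k ∈ s, (A k).PosSemidef) :
    (Matrix.of fun i j => ∏ k ∈ s, A k i j).PosSemidef := by
  classical
  induction s using Finset.induction_on with
  | empty => simpa using posSemidef_inner (E := ℂ) (fun _ : ι => (1 : ℂ))
  | insert a s ha ih =>
    have := (hA a (by simp)).hadamard (ih fun k hk => hA k (by simp [hk]))
    have e : (Matrix.of fun i j => ∏ k ∈ insert a s, A k i j)
        = (A a).hadamard (Matrix.of fun i j => ∏ k ∈ s, A k i j) := by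
      ext i j
      simp [Finset.prod_insert ha, Matrix.hadamard]
    rw [e]
    exact this

theorem posSemidef_compress {ι α : Type*} [Fintype α] (A : Matrix (α × ι) (α × ι) ℂ)
    (hA : A.PosSemidef) :
    (Matrix.of fun i j => ∑ a, ∑ b, A (a, i) (b, j)).PosSemidef := by
  classical
  refine ⟨?_, fun x => ?_⟩
  · ext i j
    simp only [Matrix.conjTranspose_apply, Matrix.of_apply, star_sum]
    rw [Finset.sum_comm]
    refine Finset.sum_congr rfl fun a _ => Finset.sum_congr rfl fun b _ => ?_
    exact congrFun (congrFun hA.1 (a, i)) (b, j)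
  · let y : α × ι →₀ ℂ := Finsupp.onFinset (Finset.univ ×ˢ x.support) (fun p => x p.2)
      (by simp)
    have hy : y.support ⊆ Finset.univ ×ˢ x.support := Finsupp.support_onFinset_subset
    have h := hA.2 y
    rw [Finsupp.sum_of_support_subset _ hy _ (by simp [Finsupp.sum])] at h
    have h2 : ∀ i ∈ Finset.univ ×ˢ x.support, (y.sum fun j b => star (y i) * A i j * b)
        = ∑ j ∈ Finset.univ ×ˢ x.support, star (x i.2) * A i j * x j.2 := fun i _ =>
      Finsupp.sum_of_support_subset _ hy _ (by simp)
    rw [Finset.sum_congr rfl h2] at h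
    refine h.trans_eq ?_
    simp only [Finsupp.sum, Matrix.of_apply, Finset.sum_product, Finset.mul_sum, Finset.sum_mul]
    rw [Finset.sum_comm]
    refine Finset.sum_congr rfl fun i _ => ?_
    symm
    rw [Finset.sum_comm]
    exact Finset.sum_congr rfl fun a _ => Finset.sum_comm

theorem posSemidef_two_point (q : ℝ) (hq : |q| ≤ 1) {ι : Type*} (s : ι → Prop)
    [DecidablePred s] :
    (Matrix.of fun i j => if (s i ↔ s j) then (1 : ℂ) else q).PosSemidef := by
  obtain ⟨h1, h2⟩ := abs_le.mp hq
  have e1 : ((Real.sqrt ((1 + q) / 2) : ℝ) : ℂ) * (Real.sqrt ((1 + q) / 2) : ℝ) = (1 + q) / 2 := by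
    rw [← Complex.ofReal_mul, Real.mul_self_sqrt (by linarith)]; push_cast; ring
  have e2 : ((Real.sqrt ((1 - q) / 2) : ℝ) : ℂ) * (Real.sqrt ((1 - q) / 2) : ℝ) = (1 - q) / 2 := by
    rw [← Complex.ofReal_mul, Real.mul_self_sqrt (by linarith)]; push_cast; ring
  have A := posSemidef_inner (E := ℂ) (fun _ : ι => ((Real.sqrt ((1 + q) / 2) : ℝ) : ℂ))
  have B := posSemidef_inner (E := ℂ)
    (fun i : ι => if s i then ((Real.sqrt ((1 - q) / 2) : ℝ) : ℂ)
      else -((Real.sqrt ((1 - q) / 2) : ℝ) : ℂ))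
  have e := A.add B
  have e' : (Matrix.of fun i j => if (s i ↔ s j) then (1 : ℂ) else q) =
      (Matrix.of fun _ _ : ι => inner ℂ ((Real.sqrt ((1 + q) / 2) : ℝ) : ℂ)
        ((Real.sqrt ((1 + q) / 2) : ℝ) : ℂ)) +
      (Matrix.of fun i j : ι => inner ℂ
        (if s i then ((Real.sqrt ((1 - q) / 2) : ℝ) : ℂ)
          else -((Real.sqrt ((1 - q) / 2) : ℝ) : ℂ))
        (if s j then ((Real.sqrt ((1 - q) / 2) : ℝ) : ℂ)
          else -((Real.sqrt ((1 - q) / 2) : ℝ) : ℂ))) := by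
    ext i j
    simp only [Matrix.of_apply, Matrix.add_apply, RCLike.inner_apply, Complex.conj_ofReal, e1]
    by_cases hi : s i <;> by_cases hj : s j <;>
      simp only [hi, hj, if_true, if_false, map_neg, Complex.conj_ofReal, neg_mul, mul_neg,
        neg_neg, e2] <;> (try simp) <;> ring
  rw [e']
  exact e

theorem pow_inversions_eq_prod (q : ℂ) {n : ℕ} (σ ρ : Equiv.Perm (Fin n)) :
    q ^ inversions ρ =
      ∏ p ∈ Finset.univ.filter (fun p : Fin n × Fin n => p.1 < p.2),
        if (σ p.1 < σ p.2 ↔ ρ (σ p.1) < ρ (σ p.2)) then 1 else q := by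
  rw [Finset.prod_ite]
  simp only [Finset.prod_const_one, one_mul, Finset.prod_const]
  congr 1
  refine Finset.card_bij'
    (fun p _ => if σ.symm p.1 < σ.symm p.2 then (σ.symm p.1, σ.symm p.2)
      else (σ.symm p.2, σ.symm p.1))
    (fun p _ => if σ p.1 < σ p.2 then (σ p.1, σ p.2) else (σ p.2, σ p.1)) ?_ ?_ ?_ ?_
  · rintro ⟨a, b⟩ h
    have h : a < b ∧ ρ b < ρ a := by simpa using h
    have h0 : σ.symm a ≠ σ.symm b := fun e => h.1.ne (σ.symm.injective e)
    split_ifs with hc <;> simp <;> grind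
  · rintro ⟨a, b⟩ h
    have h : a < b ∧ ¬ (σ a < σ b ↔ ρ (σ a) < ρ (σ b)) := by simpa using h
    have h1 : σ a ≠ σ b := fun e => h.1.ne (σ.injective e)
    have h2 : ρ (σ a) ≠ ρ (σ b) := fun e => h1 (ρ.injective e)
    split_ifs with hc <;> simp <;> grind
  · rintro ⟨a, b⟩ h
    have h : a < b ∧ ρ b < ρ a := by simpa using h
    split_ifs with hc <;> simp <;> grind
  · rintro ⟨a, b⟩ h
    have h : a < b ∧ ¬ (σ a < σ b ↔ ρ (σ a) < ρ (σ b)) := by simpa using h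
    split_ifs with hc <;> simp <;> grind


variable {H : Type*} [NormedAddCommGroup H] [InnerProductSpace ℂ H]

/-- The `q`-deformed inner product `⟨u, v⟩_q = δ ∑_π q^{i(π)} ∏_k ⟨u_k, v_{π(k)}⟩` of two elementary
tensors `u = u_1 ⊗ ⋯ ⊗ u_m` and `v = v_1 ⊗ ⋯ ⊗ v_n`, written as lists of vectors
(the empty list is the vacuum). As everywhere in Mathlib, `inner` is conjugate-linear in its
first argument. -/
def wordInner (q : ℝ) (u v : List H) : ℂ :=
  if h : u.length = v.length then
    ∑ π : Equiv.Perm (Fin u.length),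
      (q : ℂ) ^ inversions π * ∏ k, inner ℂ (u.get k) (v.get ((π k).cast h))
  else 0

theorem wordInner_eq_sum (q : ℝ) {n : ℕ} (u v : List H) (hu : u.length = n) (hv : v.length = n) :
    wordInner q u v = ∑ π : Equiv.Perm (Fin n),
      (q : ℂ) ^ inversions π * ∏ k : Fin n, inner ℂ (u.get (k.cast hu.symm))
        (v.get ((π k).cast hv.symm)) := by
  subst hu
  simp [wordInner, hv]

theorem wordInner_of_ne (q : ℝ) (u v : List H) (h : u.length ≠ v.length) :
    wordInner q u v = 0 := by
  simp [wordInner, h]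

theorem posSemidef_tuple (q : ℝ) (hq : |q| ≤ 1) (n : ℕ) :
    (Matrix.of fun u v : Fin n → H => ∑ π : Equiv.Perm (Fin n),
      (q : ℂ) ^ inversions π * ∏ k, inner ℂ (u k) (v (π k))).PosSemidef := by
  let A : Matrix (Equiv.Perm (Fin n) × (Fin n → H)) (Equiv.Perm (Fin n) × (Fin n → H)) ℂ :=
    (Matrix.of fun x y => ∏ p ∈ Finset.univ.filter (fun p : Fin n × Fin n => p.1 < p.2),
      (Matrix.of fun x y : Equiv.Perm (Fin n) × (Fin n → H) =>
        if (x.1 p.1 < x.1 p.2 ↔ y.1 p.1 < y.1 p.2) then (1 : ℂ) else q) x y).hadamard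
    (Matrix.of fun x y => ∏ k ∈ Finset.univ,
      (Matrix.of fun x y : Equiv.Perm (Fin n) × (Fin n → H) =>
        inner ℂ (x.2 (x.1 k)) (y.2 (y.1 k))) x y)
  have hA : A.PosSemidef :=
    (posSemidef_prod _ _ fun p _ => posSemidef_two_point q hq _).hadamard
      (posSemidef_prod _ _ fun k _ => posSemidef_inner
        fun x : Equiv.Perm (Fin n) × (Fin n → H) => x.2 (x.1 k))
  have hB := posSemidef_compress A hA
  have hC := hB.smul (α := ℝ) (a := ((n.factorial : ℝ)⁻¹)) (by positivity)
  have e : (Matrix.of fun u v : Fin n → H => ∑ π : Equiv.Perm (Fin n),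
      (q : ℂ) ^ inversions π * ∏ k, inner ℂ (u k) (v (π k)))
      = (n.factorial : ℝ)⁻¹ • (Matrix.of fun u v => ∑ σ, ∑ τ, A (σ, u) (τ, v)) := by
    ext u v
    have h : ∀ σ : Equiv.Perm (Fin n), ∑ τ, A (σ, u) (τ, v) = ∑ π : Equiv.Perm (Fin n),
      (q : ℂ) ^ inversions π * ∏ k, inner ℂ (u k) (v (π k)) := by
      intro σ
      rw [← Equiv.sum_comp (Equiv.mulRight σ)]
      refine Finset.sum_congr rfl fun ρ _ => ?_
      simp only [A, Matrix.hadamard, Matrix.of_apply, Equiv.coe_mulRight, Equiv.Perm.mul_apply]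
      rw [pow_inversions_eq_prod (q : ℂ) σ ρ]
      congr 1
      exact Equiv.prod_comp σ fun k => inner ℂ (u k) (v (ρ k))
    simp only [Matrix.of_apply, Matrix.smul_apply, h]
    simp [Finset.card_univ, Fintype.card_perm, Nat.factorial_ne_zero]
  rw [e]
  exact hC

theorem posSemidef_word (q : ℝ) (hq : |q| ≤ 1) :
    (Matrix.of fun u v : List H => wordInner q u v).PosSemidef := by
  classical
  let A : ℕ → Matrix (List H) (List H) ℂ := fun n =>
    (Matrix.of fun u v : List H => inner ℂ (if u.length = n then (1 : ℂ) else 0)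
      (if v.length = n then (1 : ℂ) else 0)).hadamard
    ((Matrix.of fun u v : Fin n → H => ∑ π : Equiv.Perm (Fin n),
      (q : ℂ) ^ inversions π * ∏ k, inner ℂ (u k) (v (π k))).submatrix
        (fun (u : List H) k => u.getD k 0) (fun (u : List H) k => u.getD k 0))
  have hA : ∀ n, (A n).PosSemidef := fun n =>
    (posSemidef_inner _).hadamard ((posSemidef_tuple q hq n).submatrix _)
  have hA' : ∀ n u v, A n u v = if u.length = n ∧ v.length = n then wordInner q u v else 0 := by
    intro n u v
    by_cases hu : u.length = n <;> by_cases hv : v.length = n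
    · simp [A, hu, hv, Matrix.hadamard, wordInner_eq_sum q u v hu hv]
    all_goals simp [A, hu, hv, Matrix.hadamard]
  have hs : ∀ (N : ℕ) (u v : List H), u.length < N →
      (∑ n ∈ Finset.range N, A n) u v = wordInner q u v := by
    intro N u v hu
    rw [Matrix.sum_apply]
    simp only [hA']
    by_cases h : u.length = v.length
    · rw [Finset.sum_eq_single u.length]
      · simp [h]
      · intro b _ hb
        simp [hb.symm]
      · intro h'
        exact absurd (Finset.mem_range.mpr hu) h'
    · rw [wordInner_of_ne q u v h]
      refine Finset.sum_eq_zero fun n _ => ?_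
      rw [if_neg]
      rintro ⟨h1, h2⟩
      exact h (h1.trans h2.symm)
  refine ⟨?_, fun x => ?_⟩
  · ext u v
    have := (Matrix.posSemidef_sum (Finset.range (max u.length v.length + 1))
      (fun i _ => hA i)).1
    have := congrFun (congrFun this u) v
    rw [Matrix.conjTranspose_apply, hs _ _ _ (by omega), hs _ _ _ (by omega)] at this
    exact this
  · have h := (Matrix.posSemidef_sum (Finset.range (x.support.sup List.length + 1))
      (fun i _ => hA i)).2 x
    refine h.trans_eq ?_
    refine Finset.sum_congr rfl fun u hu => Finset.sum_congr rfl fun v _ => ?_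
    have e := hs (x.support.sup List.length + 1) u v
      (Nat.lt_succ_of_le (Finset.le_sup (f := List.length) hu))
    simp only [Matrix.of_apply]
    rw [← e]


end Positivity

/-- The sesquilinear extension of `wordInner` to finite linear combinations of elementary
tensors. -/
def wordForm {H : Type*} [NormedAddCommGroup H] [InnerProductSpace ℂ H] (q : ℝ)
    (x y : List H →₀ ℂ) : ℂ :=
  x.sum fun u a => y.sum fun v b => star a * wordInner q u v * b
section Construction

theorem wordForm_conj {H : Type*} [NormedAddCommGroup H] [InnerProductSpace ℂ H] {q : ℝ}
    (hq : |q| ≤ 1) (x y : List H →₀ ℂ) :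
    (starRingEnd ℂ) (wordForm q y x) = wordForm q x y := by
  have h := (posSemidef_word (H := H) q hq).1
  simp only [wordForm, Finsupp.sum, map_sum, map_mul]
  rw [Finset.sum_comm]
  refine Finset.sum_congr rfl fun u _ => Finset.sum_congr rfl fun v _ => ?_
  have e := congrFun (congrFun h u) v
  simp only [Matrix.conjTranspose_apply, Matrix.of_apply, RCLike.star_def] at e
  rw [e]
  simp only [RCLike.star_def, RCLike.conj_conj]
  ring

theorem wordForm_nonneg {H : Type*} [NormedAddCommGroup H] [InnerProductSpace ℂ H] {q : ℝ}
    (hq : |q| ≤ 1) (x : List H →₀ ℂ) : 0 ≤ RCLike.re (wordForm q x x) :=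
  (RCLike.nonneg_iff.mp ((posSemidef_word (H := H) q hq).2 x)).1

theorem wordForm_add_left {H : Type*} [NormedAddCommGroup H] [InnerProductSpace ℂ H] (q : ℝ)
    (x y z : List H →₀ ℂ) : wordForm q (x + y) z = wordForm q x z + wordForm q y z := by
  refine Finsupp.sum_add_index' (fun u => by simp) fun u a b => ?_
  rw [← Finsupp.sum_add]
  simp only [star_add, add_mul]

theorem wordForm_smul_left {H : Type*} [NormedAddCommGroup H] [InnerProductSpace ℂ H] (q : ℝ)
    (x y : List H →₀ ℂ) (r : ℂ) :
    wordForm q (r • x) y = (starRingEnd ℂ) r * wordForm q x y := by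
  refine (Finsupp.sum_smul_index' (fun u => by simp)).trans ?_
  simp only [wordForm, Finsupp.sum, Finset.mul_sum]
  refine Finset.sum_congr rfl fun u _ => Finset.sum_congr rfl fun v _ => ?_
  simp only [smul_eq_mul, RCLike.star_def, map_mul]
  ring

/-- The permutation of `{0, …, n}` sending `0` to `k` and mapping the rest as `π`. -/
def consPerm {n : ℕ} (k : Fin (n + 1)) (π : Equiv.Perm (Fin n)) : Equiv.Perm (Fin (n + 1)) :=
  (finSuccEquiv' 0).trans ((Equiv.optionCongr π).trans (finSuccEquiv' k).symm)

theorem consPerm_zero {n : ℕ} (k : Fin (n + 1)) (π : Equiv.Perm (Fin n)) :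
    consPerm k π 0 = k := by
  simp [consPerm]

theorem consPerm_succ {n : ℕ} (k : Fin (n + 1)) (π : Equiv.Perm (Fin n)) (i : Fin n) :
    consPerm k π i.succ = k.succAbove (π i) := by
  have : finSuccEquiv' (0 : Fin (n + 1)) i.succ = some i := by
    rw [← Fin.succAbove_zero]; exact finSuccEquiv'_succAbove 0 i
  simp [consPerm, this]

theorem inversions_consPerm {n : ℕ} (k : Fin (n + 1)) (π : Equiv.Perm (Fin n)) :
    inversions (consPerm k π) = k + inversions π := by
  have hk : ∑ i : Fin n, (if k.succAbove (π i) < k then 1 else 0) = (k : ℕ) := by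
    rw [Equiv.sum_comp π fun i => if k.succAbove i < k then 1 else 0]
    simp only [Fin.succAbove_lt_iff_castSucc_lt]
    rw [← Finset.card_filter]
    have := Fin.card_filter_val_lt (n := n) (m := k)
    simpa [Fin.lt_def, Nat.lt_succ_iff.mp k.2] using this
  simp only [inversions, Finset.card_filter, Fintype.sum_prod_type, Fin.sum_univ_succ,
    consPerm_zero, consPerm_succ]
  simp only [Fin.succ_lt_succ_iff, Fin.succ_pos, true_and, lt_self_iff_false, false_and, if_false,
    Fin.not_lt_zero, zero_add, hk, Fin.succAbove_lt_succAbove_iff]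

theorem sum_consPerm {n : ℕ} (F : Equiv.Perm (Fin (n + 1)) → ℂ) :
    ∑ π, F π = ∑ k, ∑ π, F (consPerm k π) := by
  rw [← Fintype.sum_prod_type']
  symm
  refine Fintype.sum_bijective (fun p : Fin (n + 1) × Equiv.Perm (Fin n) => consPerm p.1 p.2) ?_
    _ _ (fun _ => rfl)
  rw [Fintype.bijective_iff_injective_and_card]
  refine ⟨?_, by simp [Fintype.card_perm, Nat.factorial_succ]⟩
  rintro ⟨k, π⟩ ⟨k', π'⟩ h
  have h0 : k = k' := by
    have := congrArg (fun σ : Equiv.Perm _ => σ 0) h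
    simpa [consPerm_zero] using this
  subst h0
  congr 1
  ext i
  have := congrArg (fun σ : Equiv.Perm _ => σ i.succ) h
  simp only [consPerm_succ] at this
  exact congrArg Fin.val (Fin.succAbove_right_injective this)

/-- Finite linear combinations of elementary tensors `f_1 ⊗ ⋯ ⊗ f_n`, `n ≥ 0`, carrying the
`q`-deformed inner product. The multilinear relations between elementary tensors are not divided
out here: the differences of their two sides are null vectors of the `q`-deformed inner
product, and hence vanish in the (separated) completion `Fock q H`. -/
def PreFock (_q : Set.Ioo (-1 : ℝ) 1) (H : Type*) : Type _ := List H →₀ ℂ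

variable (q : Set.Ioo (-1 : ℝ) 1) (H : Type*) [NormedAddCommGroup H] [InnerProductSpace ℂ H]

theorem abs_lt_one (q : Set.Ioo (-1 : ℝ) 1) : |(q : ℝ)| < 1 := abs_lt.mpr q.2

instance : AddCommGroup (PreFock q H) := inferInstanceAs (AddCommGroup (List H →₀ ℂ))
instance : Module ℂ (PreFock q H) := inferInstanceAs (Module ℂ (List H →₀ ℂ))

variable {H}

/-- The elementary tensor `f_1 ⊗ ⋯ ⊗ f_n`, for `u = [f_1, …, f_n]`. -/
def preTensor (u : List H) : PreFock q H := (Finsupp.single u 1 : List H →₀ ℂ)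

variable (H)

/-- The `q`-deformed inner product as a positive semidefinite sesquilinear form. -/
abbrev preInnerCore : PreInnerProductSpace.Core ℂ (PreFock q H) where
  inner x y := wordForm (q : ℝ) x y
  conj_inner_symm x y := wordForm_conj (abs_lt_one q).le x y
  re_inner_nonneg x := wordForm_nonneg (abs_lt_one q).le x
  add_left x y z := wordForm_add_left (q : ℝ) x y z
  smul_left x y r := wordForm_smul_left (q : ℝ) x y r

instance : SeminormedAddCommGroup (PreFock q H) :=
  InnerProductSpace.Core.toSeminormedAddCommGroup (𝕜 := ℂ) (c := preInnerCore q H)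

instance : InnerProductSpace ℂ (PreFock q H) := InnerProductSpace.ofCore (preInnerCore q H)

variable {H}

theorem inner_preTensor (u v : List H) :
    inner ℂ (preTensor q u) (preTensor q v) = wordInner (q : ℝ) u v := by
  change Finsupp.sum (Finsupp.single u (1 : ℂ)) (fun u a => Finsupp.sum (Finsupp.single v (1 : ℂ))
    fun v b => star a * wordInner (q : ℝ) u v * b) = _
  simp

theorem preFock_induction {p : PreFock q H → Prop} (x : PreFock q H) (h0 : p 0)
    (hadd : ∀ x y, p x → p y → p (x + y)) (hs : ∀ (c : ℂ) u, p (c • preTensor q u)) : p x := by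
  refine Finsupp.induction_linear (motive := p) x h0 hadd fun u c => ?_
  have : (Finsupp.single u c : List H →₀ ℂ) = c • preTensor q u := by
    change _ = c • (Finsupp.single u 1 : List H →₀ ℂ)
    simp
  rw [this]
  exact hs c u

/-- The creator on the algebraic level: `f_1 ⊗ ⋯ ⊗ f_n ↦ f ⊗ f_1 ⊗ ⋯ ⊗ f_n`. -/
def preCreator (f : H) : PreFock q H →ₗ[ℂ] PreFock q H :=
  Finsupp.linearCombination ℂ fun u : List H => preTensor q (f :: u)

/-- The annihilator on the algebraic level:
`f_1 ⊗ ⋯ ⊗ f_n ↦ ∑_k q^{k-1} ⟨f, f_k⟩ f_1 ⊗ ⋯ ⊗ f_{k-1} ⊗ f_{k+1} ⊗ ⋯ ⊗ f_n`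
(the index `k` starts from `0` in the code). -/
def preAnnihilator (f : H) : PreFock q H →ₗ[ℂ] PreFock q H :=
  Finsupp.linearCombination ℂ fun u : List H =>
    ∑ k : Fin u.length, (((q : ℝ) : ℂ) ^ (k : ℕ) * inner ℂ f (u.get k)) •
      preTensor q (u.eraseIdx k)

theorem preCreator_preTensor (f : H) (u : List H) :
    preCreator q f (preTensor q u) = preTensor q (f :: u) :=
  (Finsupp.linearCombination_single ℂ 1 u).trans (one_smul ℂ _)

theorem preAnnihilator_preTensor (f : H) (u : List H) :
    preAnnihilator q f (preTensor q u) =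
      ∑ k : Fin u.length, (((q : ℝ) : ℂ) ^ (k : ℕ) * inner ℂ f (u.get k)) •
        preTensor q (u.eraseIdx k) :=
  (Finsupp.linearCombination_single ℂ 1 u).trans (one_smul ℂ _)

theorem wordInner_cons (q : ℝ) (f : H) (u v : List H) :
    wordInner q (f :: u) v = ∑ k : Fin v.length,
      (q : ℂ) ^ (k : ℕ) * inner ℂ f (v.get k) * wordInner q u (v.eraseIdx k) := by
  by_cases h : v.length = u.length + 1
  · obtain ⟨n, hn⟩ : ∃ n, u.length = n := ⟨_, rfl⟩
    have hv : v.length = n + 1 := by omega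
    rw [wordInner_eq_sum q (n := n + 1) (f :: u) v (by simp [hn]) hv, sum_consPerm,
      ← Equiv.sum_comp (finCongr hv.symm)]
    refine Finset.sum_congr rfl fun k _ => ?_
    have hl : (v.eraseIdx k).length = n := by
      rw [List.length_eraseIdx_of_lt (by omega)]; omega
    have e : ((finCongr hv.symm k : Fin v.length) : ℕ) = k := rfl
    rw [e, wordInner_eq_sum q u (v.eraseIdx k) hn hl, Finset.mul_sum]
    refine Finset.sum_congr rfl fun π _ => ?_
    rw [inversions_consPerm, Fin.prod_univ_succ, pow_add]
    have e1 : ∀ i : Fin n, inner ℂ ((f :: u).get (i.succ.cast (by simp [hn])))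
        (v.get ((consPerm k π i.succ).cast hv.symm)) =
        inner ℂ (u.get (i.cast hn.symm)) ((v.eraseIdx k).get ((π i).cast hl.symm)) := by
      intro i
      congr 1
      have hs : ((k.succAbove (π i) : Fin (n + 1)) : ℕ) =
          if (π i : ℕ) < k then (π i : ℕ) else π i + 1 := by
        simp only [Fin.succAbove, Fin.lt_def, Fin.val_castSucc]
        split_ifs <;> rfl
      simp only [consPerm_succ, List.get_eq_getElem, List.getElem_eraseIdx, Fin.val_cast, hs]
      by_cases hlt : (π i : ℕ) < k <;> simp [hlt]
    simp only [e1]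
    have e2 : inner ℂ ((f :: u).get ((0 : Fin (n + 1)).cast (by simp [hn])))
        (v.get ((consPerm k π 0).cast hv.symm)) = inner ℂ f (v.get (finCongr hv.symm k)) := by
      simp [consPerm_zero]
    rw [e2]
    ring
  · rw [wordInner_of_ne q (f :: u) v (by simp; omega)]
    symm
    refine Finset.sum_eq_zero fun k _ => ?_
    rw [wordInner_of_ne, mul_zero]
    rw [List.length_eraseIdx_of_lt k.2]
    have := k.2
    omega

theorem inner_preCreator (f : H) (x y : PreFock q H) :
    inner ℂ (preCreator q f x) y = inner ℂ x (preAnnihilator q f y) := by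
  induction x using preFock_induction with
  | h0 => simp
  | hadd x x' h h' => simp [inner_add_left, h, h']
  | hs c u =>
    induction y using preFock_induction with
    | h0 => simp
    | hadd x x' h h' => simp only [inner_add_right, map_add, h, h']
    | hs d v =>
      simp only [map_smul, inner_smul_left, inner_smul_right, preCreator_preTensor,
        preAnnihilator_preTensor, inner_preTensor, inner_sum, wordInner_cons]
      rw [Finset.mul_sum]
      congr 1
      exact Finset.sum_congr rfl fun k _ => by ring

theorem preAnnihilator_preCreator (f g : H) (x : PreFock q H) :
    preAnnihilator q f (preCreator q g x) =
      inner ℂ f g • x + ((q : ℝ) : ℂ) • preCreator q g (preAnnihilator q f x) := by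
  induction x using preFock_induction with
  | h0 => simp
  | hadd x x' h h' => simp only [map_add, h, h', smul_add]; abel
  | hs c u =>
    simp only [map_smul, preCreator_preTensor, preAnnihilator_preTensor, map_sum]
    have e : (∑ k : Fin (g :: u).length, (((q : ℝ) : ℂ) ^ (k : ℕ) * inner ℂ f ((g :: u).get k)) •
        preTensor q ((g :: u).eraseIdx k)) = inner ℂ f g • preTensor q u +
        ((q : ℝ) : ℂ) • ∑ k : Fin u.length, (((q : ℝ) : ℂ) ^ (k : ℕ) * inner ℂ f (u.get k)) •
          preTensor q (g :: u.eraseIdx k) := by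
      rw [show (∑ k : Fin (g :: u).length, (((q : ℝ) : ℂ) ^ (k : ℕ) *
        inner ℂ f ((g :: u).get k)) • preTensor q ((g :: u).eraseIdx k)) = _ from
        Fin.sum_univ_succ (n := u.length) _]
      simp [Finset.smul_sum, smul_smul, pow_succ', mul_assoc]
    rw [e, smul_add, smul_comm c, smul_comm c]

/-- `√(‖f‖² / (1 - |q|))`, a bound for the norms of the creator and the annihilator of `f`. -/
def fockBound (f : H) : ℝ := Real.sqrt (‖f‖ ^ 2 / (1 - |(q : ℝ)|))

theorem norm_sq_preCreator (f : H) (x : PreFock q H) :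
    ‖preCreator q f x‖ ^ 2 = ‖f‖ ^ 2 * ‖x‖ ^ 2 + (q : ℝ) * ‖preAnnihilator q f x‖ ^ 2 := by
  have h : inner ℂ (preCreator q f x) (preCreator q f x) = ((‖f‖ ^ 2 * ‖x‖ ^ 2 +
      (q : ℝ) * ‖preAnnihilator q f x‖ ^ 2 : ℝ) : ℂ) := by
    rw [inner_preCreator, preAnnihilator_preCreator, inner_add_right, inner_smul_right,
      inner_smul_right, ← inner_conj_symm x (preCreator q f _), inner_preCreator,
      inner_conj_symm, inner_self_eq_norm_sq_to_K, inner_self_eq_norm_sq_to_K, inner_self_eq_norm_sq_to_K]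
    push_cast
    rfl
  rw [inner_self_eq_norm_sq_to_K] at h
  have h' : ((‖preCreator q f x‖ ^ 2 : ℝ) : ℂ) = ((‖f‖ ^ 2 * ‖x‖ ^ 2 +
      (q : ℝ) * ‖preAnnihilator q f x‖ ^ 2 : ℝ) : ℂ) := by
    rw [← h]; push_cast; rfl
  exact Complex.ofReal_injective h'

theorem norm_preAnnihilator_le_of (f : H) (x : PreFock q H) {C : ℝ} (hC : 0 ≤ C)
    (h : ‖preCreator q f (preAnnihilator q f x)‖ ≤ C * ‖preAnnihilator q f x‖) :
    ‖preAnnihilator q f x‖ ≤ C * ‖x‖ := by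
  have h1 : ‖preAnnihilator q f x‖ ^ 2 ≤ C * ‖preAnnihilator q f x‖ * ‖x‖ := by
    have h2 : ‖inner ℂ (preAnnihilator q f x) (preAnnihilator q f x)‖ ≤
        ‖preCreator q f (preAnnihilator q f x)‖ * ‖x‖ := by
      rw [← inner_preCreator]
      exact norm_inner_le_norm _ _
    rw [inner_self_eq_norm_sq_to_K] at h2
    have h3 : ‖preAnnihilator q f x‖ ^ 2 ≤
        ‖preCreator q f (preAnnihilator q f x)‖ * ‖x‖ := by
      simpa using h2
    exact h3.trans (by gcongr)
  rcases (norm_nonneg (preAnnihilator q f x)).eq_or_lt with h0 | h0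
  · rw [← h0]; positivity
  · nlinarith

theorem preAnnihilator_preCreator_bound (f : H) (n : ℕ) (x : PreFock q H)
    (hx : x ∈ Submodule.span ℂ (preTensor q '' {u : List H | u.length ≤ n})) :
    ‖preCreator q f x‖ ≤ fockBound q f * ‖x‖ := by
  have hq := abs_lt_one q
  have hq' : 0 < 1 - |(q : ℝ)| := by linarith
  have hB : 0 ≤ fockBound q f := Real.sqrt_nonneg _
  have hB2 : fockBound q f ^ 2 * (1 - |(q : ℝ)|) = ‖f‖ ^ 2 := by
    rw [fockBound, Real.sq_sqrt (by positivity)]; field_simp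
  have key : ∀ x : PreFock q H, ‖preAnnihilator q f x‖ ≤ fockBound q f * ‖x‖ →
      ‖preCreator q f x‖ ≤ fockBound q f * ‖x‖ := by
    intro x hx
    refine le_of_sq_le_sq ?_ (by positivity)
    have h1 : ‖preAnnihilator q f x‖ ^ 2 ≤ (fockBound q f * ‖x‖) ^ 2 := by gcongr
    have h2 : (q : ℝ) * ‖preAnnihilator q f x‖ ^ 2 ≤ |(q : ℝ)| * (fockBound q f * ‖x‖) ^ 2 :=
      (mul_le_mul_of_nonneg_right (le_abs_self _) (by positivity)).trans
        (mul_le_mul_of_nonneg_left h1 (abs_nonneg _))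
    rw [norm_sq_preCreator, ← hB2]
    nlinarith
  induction n generalizing x with
  | zero =>
    apply key
    have : preAnnihilator q f x = 0 := by
      induction hx using Submodule.span_induction with
      | mem x h =>
        obtain ⟨u, hu, rfl⟩ := h
        obtain rfl : u = [] := List.length_eq_zero_iff.mp (Nat.le_zero.mp hu)
        rw [preAnnihilator_preTensor]
        exact Finset.sum_eq_zero fun k _ => k.elim0
      | zero => simp
      | add x y _ _ h h' => simp [h, h']
      | smul c x _ h => simp [h]
    rw [this, norm_zero]
    positivity
  | succ n ih =>
    apply key
    refine norm_preAnnihilator_le_of q f x hB (ih _ ?_)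
    induction hx using Submodule.span_induction with
    | mem x h =>
      obtain ⟨u, hu, rfl⟩ := h
      rw [preAnnihilator_preTensor]
      refine Submodule.sum_mem _ fun k _ => Submodule.smul_mem _ _ (Submodule.subset_span ?_)
      refine ⟨_, ?_, rfl⟩
      have hu : u.length ≤ n + 1 := hu
      change (u.eraseIdx k).length ≤ n
      rw [List.length_eraseIdx_of_lt k.2]
      omega
    | zero => simp
    | add x y _ _ h h' => rw [map_add]; exact Submodule.add_mem _ h h'
    | smul c x _ h => rw [map_smul]; exact Submodule.smul_mem _ _ h

theorem norm_preCreator_le (f : H) (x : PreFock q H) :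
    ‖preCreator q f x‖ ≤ fockBound q f * ‖x‖ := by
  have : ∃ n : ℕ, x ∈ Submodule.span ℂ (preTensor q '' {u : List H | u.length ≤ n}) := by
    induction x using preFock_induction with
    | h0 => exact ⟨0, Submodule.zero_mem _⟩
    | hadd x y h h' =>
      obtain ⟨n, hn⟩ := h
      obtain ⟨m, hm⟩ := h'
      refine ⟨max n m, Submodule.add_mem _ (Submodule.span_mono ?_ hn)
        (Submodule.span_mono ?_ hm)⟩ <;> apply Set.image_mono <;> intro u hu
      · exact le_trans hu (le_max_left n m)
      · exact le_trans hu (le_max_right n m)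
    | hs c u =>
      exact ⟨u.length, Submodule.smul_mem _ _ (Submodule.subset_span ⟨u, le_refl u.length, rfl⟩)⟩
  obtain ⟨n, hn⟩ := this
  exact preAnnihilator_preCreator_bound q f n x hn

theorem norm_preAnnihilator_le (f : H) (x : PreFock q H) :
    ‖preAnnihilator q f x‖ ≤ fockBound q f * ‖x‖ :=
  norm_preAnnihilator_le_of q f x (Real.sqrt_nonneg _) (norm_preCreator_le q f _)

end Construction

/-- The `q`-deformed Fock space `Γ_q(H)`. -/
abbrev Fock (q : Set.Ioo (-1 : ℝ) 1) (H : Type*) [NormedAddCommGroup H]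
    [InnerProductSpace ℂ H] : Type _ :=
  UniformSpace.Completion (PreFock q H)

section Operators

variable (q : Set.Ioo (-1 : ℝ) 1) {H : Type*} [NormedAddCommGroup H] [InnerProductSpace ℂ H]

/-- The elementary tensor `f_1 ⊗ ⋯ ⊗ f_n` in `Γ_q(H)`, for `u = [f_1, …, f_n]`. -/
def tensor (u : List H) : Fock q H := (preTensor q u : PreFock q H)

variable (H) in
/-- The vacuum vector `ζ_q`. -/
def vacuum : Fock q H := tensor q []

/-- The creator `l†(f)`. -/
def creator (f : H) : Fock q H →L[ℂ] Fock q H :=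
  ((preCreator q f).mkContinuous (fockBound q f) (norm_preCreator_le q f)).completion

/-- The annihilator `l(f)`. -/
def annihilator (f : H) : Fock q H →L[ℂ] Fock q H :=
  ((preAnnihilator q f).mkContinuous (fockBound q f) (norm_preAnnihilator_le q f)).completion

/-- With `creator_add` and `creator_smul`, this gives the multilinearity of elementary tensors. -/
theorem tensor_cons (f : H) (u : List H) : tensor q (f :: u) = creator q f (tensor q u) := by
  rw [creator, tensor, tensor, ContinuousLinearMap.completion_apply_coe]
  simp [preCreator_preTensor]

theorem creator_ext (T S : Fock q H →L[ℂ] Fock q H)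
    (h : ∀ x y : PreFock q H, inner ℂ (T x) (y : Fock q H) = inner ℂ (S x) (y : Fock q H)) :
    T = S := by
  ext x
  induction x using UniformSpace.Completion.induction_on with
  | hp => exact isClosed_eq T.continuous S.continuous
  | ih x =>
    refine ext_inner_right ℂ fun y => ?_
    induction y using UniformSpace.Completion.induction_on with
    | hp => exact isClosed_eq (by fun_prop) (by fun_prop)
    | ih y => exact h x y

theorem inner_creator (f : H) (x y : PreFock q H) :
    inner ℂ (creator q f x) (y : Fock q H) = inner ℂ x (preAnnihilator q f y) := by
  rw [creator, ContinuousLinearMap.completion_apply_coe, UniformSpace.Completion.inner_coe]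
  exact inner_preCreator q f x y

theorem creator_add (f g : H) : creator q (f + g) = creator q f + creator q g := by
  refine creator_ext q _ _ fun x y => ?_
  rw [add_apply, inner_add_left, inner_creator, inner_creator, inner_creator,
    ← inner_add_right]
  congr 1
  induction y using preFock_induction with
  | h0 => simp
  | hadd y z h h' => simp only [map_add, h, h']; abel
  | hs c u => simp [preAnnihilator_preTensor, mul_add, add_smul,
      Finset.sum_add_distrib]

theorem creator_smul (c : ℂ) (f : H) : creator q (c • f) = c • creator q f := by
  refine creator_ext q _ _ fun x y => ?_
  rw [smul_apply, inner_smul_left, inner_creator, inner_creator,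
    ← inner_smul_right]
  congr 1
  induction y using preFock_induction with
  | h0 => simp
  | hadd y z h h' => simp only [map_add, h, h', smul_add]
  | hs d u =>
    simp only [map_smul, preAnnihilator_preTensor, inner_smul_left, Finset.smul_sum, smul_smul]
    exact Finset.sum_congr rfl fun k _ => by ring_nf

end Operators

/-! ### The monoids of index maps -/

/-- The group `ℙ_ℤ` of finite permutations of `ℤ`, under composition. -/
def finitePermutations : Submonoid (Function.End ℤ) where
  carrier := {g | Function.Bijective g ∧ {k | g k ≠ k}.Finite}
  one_mem' := ⟨Function.bijective_id, by simp [Function.End.one_def]⟩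
  mul_mem' := by
    rintro f g ⟨hf, hf'⟩ ⟨hg, hg'⟩
    refine ⟨hf.comp hg, (hf'.union hg').subset fun k hk => ?_⟩
    by_contra h
    simp only [Set.mem_union, Set.mem_ofPred_eq, not_or, not_not] at h
    exact hk (show f (g k) = k by rw [h.2, h.1])

/-- The monoid `𝕃_ℤ` of strictly increasing maps `ℤ → ℤ`, under composition. -/
def increasingMaps : Submonoid (Function.End ℤ) where
  carrier := {g | StrictMono g}
  one_mem' := strictMono_id
  mul_mem' hf hg := hf.comp hg

/-- The group of shifts of `ℤ`, generated by `τ(k) = k + 1` and identified with `ℤ`. -/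
def shifts : Submonoid (Function.End ℤ) where
  carrier := {g | ∃ n : ℤ, ∀ k, g k = k + n}
  one_mem' := ⟨0, fun k => (add_zero k).symm⟩
  mul_mem' := by
    rintro f g ⟨m, hm⟩ ⟨n, hn⟩
    exact ⟨n + m, fun k => show f (g k) = _ by rw [hm, hn, add_assoc]⟩

/-! ### C⋆-algebras generated by sequences of operators, their index actions and states -/

section Algebra

variable {F : Type*} [NormedAddCommGroup F] [InnerProductSpace ℂ F] [CompleteSpace F]

/-- The unital C⋆-algebra of operators on `F` generated by the operators `a j`, `j ∈ ℤ`. -/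
def cstarGen (a : ℤ → F →L[ℂ] F) : StarSubalgebra ℂ (F →L[ℂ] F) :=
  (StarAlgebra.adjoin ℂ (Set.range a)).topologicalClosure

/-- The operator `a j` as an element of the C⋆-algebra generated by the sequence `a`. -/
def gen (a : ℤ → F →L[ℂ] F) (j : ℤ) : cstarGen a :=
  ⟨a j, StarSubalgebra.le_topologicalClosure _ (StarAlgebra.subset_adjoin ℂ _ ⟨j, rfl⟩)⟩

/-- The natural action of a monoid `M` of maps `g : ℤ → ℤ` on the C⋆-algebra generated by the
sequence `a`: the action by unital `⋆`-endomorphisms with `a j ↦ a (g j)`. There is at most one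
(see the instance below). -/
structure IndexAction (M : Submonoid (Function.End ℤ)) (a : ℤ → F →L[ℂ] F) where
  toHom : M →* (cstarGen a →⋆ₐ[ℂ] cstarGen a)
  map_gen : ∀ (g : M) (j : ℤ), toHom g (gen a j) = gen a ((g : Function.End ℤ) j)

theorem starAlgHom_ext_gen (a : ℤ → F →L[ℂ] F) (φ ψ : cstarGen a →⋆ₐ[ℂ] cstarGen a)
    (h : ∀ j, φ (gen a j) = ψ (gen a j)) : φ = ψ := by
  have : IsClosed (cstarGen a : Set (F →L[ℂ] F)) :=
    StarSubalgebra.isClosed_topologicalClosure _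
  letI : CStarAlgebra (cstarGen a) := StarSubalgebra.cstarAlgebra (cstarGen a)
  have hc : ∀ χ : cstarGen a →⋆ₐ[ℂ] cstarGen a, Continuous χ := fun χ =>
    AddMonoidHomClass.continuous_of_bound χ 1 fun x => by
      simpa using NonUnitalStarAlgHom.norm_apply_le χ x
  refine StarAlgHom.ext_topologicalClosure (S := StarAlgebra.adjoin ℂ (Set.range a))
    (hc φ) (hc ψ) (StarAlgHom.ext_adjoin ?_)
  rintro ⟨_, _⟩ ⟨j, rfl⟩
  exact h j

instance (M : Submonoid (Function.End ℤ)) (a : ℤ → F →L[ℂ] F) : Subsingleton (IndexAction M a) := by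
  refine ⟨fun α β => ?_⟩
  obtain ⟨α, hα⟩ := α
  obtain ⟨β, hβ⟩ := β
  congr 1
  ext1 g
  exact starAlgHom_ext_gen a _ _ fun j => (hα g j).trans (hβ g j).symm

/-- A state: a positive normalized linear functional. -/
structure IsState {A : StarSubalgebra ℂ (F →L[ℂ] F)} (φ : A →ₗ[ℂ] ℂ) : Prop where
  nonneg : ∀ x : A, 0 ≤ φ (star x * x)
  map_one : φ 1 = 1

/-- The set `𝒮_M` of the states that are invariant under the natural action of `M`. -/
def IndexAction.invariantStates {M : Submonoid (Function.End ℤ)} {a : ℤ → F →L[ℂ] F}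
    (α : IndexAction M a) : Set (cstarGen a →ₗ[ℂ] ℂ) :=
  {φ | IsState φ ∧ ∀ (g : M) (x : cstarGen a), φ (α.toHom g x) = φ x}

/-- The vector functional `x ↦ ⟨ζ, x ζ⟩`. -/
def vectorFunctional (A : StarSubalgebra ℂ (F →L[ℂ] F)) (ζ : F) : A →ₗ[ℂ] ℂ where
  toFun x := inner ℂ ζ ((x : F →L[ℂ] F) ζ)
  map_add' x y := by simp
  map_smul' c x := by simp

end Algebra

/-! ### The `q`-deformed sequences over `ℓ²(ℤ)` -/

/-- The Hilbert space `ℓ²(ℤ)`. -/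
abbrev EllTwo : Type := lp (fun _ : ℤ => ℂ) 2

/-- The canonical basis vector `e_j` of `ℓ²(ℤ)`. -/
def e (j : ℤ) : EllTwo := lp.single 2 j 1

/-- The annihilators `l_j = l(e_j)` on `Γ_q(ℓ²(ℤ))`. -/
def l (q : Set.Ioo (-1 : ℝ) 1) (j : ℤ) : Fock q EllTwo →L[ℂ] Fock q EllTwo := annihilator q (e j)

/-- The operators `s_j = l_j + l_j†` on `Γ_q(ℓ²(ℤ))`. -/
def s (q : Set.Ioo (-1 : ℝ) 1) (j : ℤ) : Fock q EllTwo →L[ℂ] Fock q EllTwo :=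
  annihilator q (e j) + creator q (e j)

/-- The Fock vacuum vector state `ω_q = ⟨· ζ_q, ζ_q⟩` on the C⋆-algebra generated by a sequence of
operators on `Γ_q(ℓ²(ℤ))`. -/
def fockVacuumState (q : Set.Ioo (-1 : ℝ) 1)
    (a : ℤ → Fock q EllTwo →L[ℂ] Fock q EllTwo) : cstarGen a →ₗ[ℂ] ℂ :=
  vectorFunctional (cstarGen a) (vacuum q EllTwo)

end QFock

end

/-! The theorem is a unique ergodicity statement in norm: for every `x` in `𝔑_q` the Cesàro means of
the shifts of `x` converge in operator norm to `ω_q(x) 1`. A shift-invariant state is norm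
continuous and constant along these means, so it equals `ω_q`. Since `s_j = l_j + l_j†`, `𝔖_q` lies
inside `𝔑_q` and the same argument covers it.

The convergence comes from the relation `l_i l_j† = δ_ij + q l_j† l_i`. It bounds every finite sum
`∑ l_k† l_k` by `1 / (1 - |q|)`, uniformly in the number of terms (`norm_sum_star_mul_self_le`). By
Cauchy–Schwarz a sum of `N` terms `l_k† T_k` with bounded `T_k` has norm `O(√N)`, so its mean is
`O(1/√N)` (`norm_sum_star_mul_le`). Hence the means of `l_j† v`, and by adjoints of `v l_j`, tend to
zero. Wick ordering spans the algebra generated by the `l_j` and their adjoints by `1` and such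
products, and density gives the closure.

The actions are spatial for permutations: a permutation of the basis of `ℓ²(ℤ)` is second quantized
to a unitary fixing the vacuum and permuting the `l_j`. For an injective index map the endomorphism
is the pointwise norm limit of conjugations by finite permutations that agree with the map on
growing intervals. Consequently `ω_q` is invariant under all three monoids, and a symmetric state is
shift-invariant because shifts are such limits. Strictly increasing maps include the shifts. -/

noncomputable section
namespace QFock
open scoped ComplexOrder

/-! ### Second quantization of unitaries, and the operator relations on the completed Fock space. -/

section SecondQuantization

variable (q : Set.Ioo (-1 : ℝ) 1) {H : Type*} [NormedAddCommGroup H] [InnerProductSpace ℂ H]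

/-- The algebraic second quantization `f_1 ⊗ ⋯ ⊗ f_n ↦ V f_1 ⊗ ⋯ ⊗ V f_n`. -/
def preSecondQuantization (V : H →ₗᵢ[ℂ] H) : PreFock q H →ₗ[ℂ] PreFock q H :=
  Finsupp.linearCombination ℂ fun u : List H => preTensor q (u.map V)

theorem preSecondQuantization_preTensor (V : H →ₗᵢ[ℂ] H) (u : List H) :
    preSecondQuantization q V (preTensor q u) = preTensor q (u.map V) :=
  (Finsupp.linearCombination_single ℂ 1 u).trans (one_smul ℂ _)

/-- The `q`-inner product sees its letters only through their pairwise inner products, which an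
isometry preserves. -/
theorem wordInner_map (V : H →ₗᵢ[ℂ] H) (q : ℝ) (u v : List H) :
    wordInner q (u.map V) (v.map V) = wordInner q u v := by
  by_cases h : u.length = v.length
  · rw [wordInner_eq_sum q (n := u.length) _ _ (by simp) (by simp [h]),
      wordInner_eq_sum q (n := u.length) _ _ rfl h.symm]
    simp
  · rw [wordInner_of_ne q _ _ h, wordInner_of_ne q _ _ (by simpa using h)]

theorem inner_preSecondQuantization (V : H →ₗᵢ[ℂ] H) (x y : PreFock q H) :
    inner ℂ (preSecondQuantization q V x) (preSecondQuantization q V y) = inner ℂ x y := by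
  induction x using preFock_induction with
  | h0 => simp
  | hadd x x' h h' => simp [inner_add_left, h, h']
  | hs c u =>
    induction y using preFock_induction with
    | h0 => simp
    | hadd x x' h h' => simp only [inner_add_right, map_add, h, h']
    | hs d v =>
      simp only [map_smul, inner_smul_left, inner_smul_right, preSecondQuantization_preTensor,
        inner_preTensor, wordInner_map]

/-- The second quantization of an isometry, as a continuous linear map. -/
def secondQuantizationMap (V : H →ₗᵢ[ℂ] H) : Fock q H →L[ℂ] Fock q H :=
  ((preSecondQuantization q V).mkContinuous 1 fun x => by
    rw [one_mul, ← sq_le_sq₀ (norm_nonneg _) (norm_nonneg _), ← inner_self_eq_norm_sq (𝕜 := ℂ),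
      inner_preSecondQuantization, inner_self_eq_norm_sq]).completion

theorem secondQuantizationMap_coe (V : H →ₗᵢ[ℂ] H) (x : PreFock q H) :
    secondQuantizationMap q V x = (preSecondQuantization q V x : PreFock q H) := by
  rw [secondQuantizationMap, ContinuousLinearMap.completion_apply_coe]
  rfl

theorem norm_secondQuantizationMap (V : H →ₗᵢ[ℂ] H) (x : Fock q H) :
    ‖secondQuantizationMap q V x‖ = ‖x‖ := by
  induction x using UniformSpace.Completion.induction_on with
  | hp => exact isClosed_eq (by fun_prop) (by fun_prop)
  | ih x =>
    rw [secondQuantizationMap_coe, UniformSpace.Completion.norm_coe,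
      UniformSpace.Completion.norm_coe, ← sq_eq_sq₀ (norm_nonneg _) (norm_nonneg _),
      ← inner_self_eq_norm_sq (𝕜 := ℂ), inner_preSecondQuantization, inner_self_eq_norm_sq]

theorem secondQuantizationMap_comp (V W : H →ₗᵢ[ℂ] H) (h : ∀ f, V (W f) = f) (x : Fock q H) :
    secondQuantizationMap q V (secondQuantizationMap q W x) = x := by
  induction x using UniformSpace.Completion.induction_on with
  | hp => exact isClosed_eq (by fun_prop) (by fun_prop)
  | ih x =>
    rw [secondQuantizationMap_coe, secondQuantizationMap_coe]
    congr 1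
    induction x using preFock_induction with
    | h0 => simp
    | hadd x y hx hy => simp only [map_add, hx, hy]
    | hs c u =>
      simp only [map_smul, preSecondQuantization_preTensor, List.map_map]
      rw [show (⇑V ∘ ⇑W) = id from funext h, List.map_id]

/-- The second quantization of a unitary operator. -/
def secondQuantization (V : H ≃ₗᵢ[ℂ] H) : Fock q H ≃ₗᵢ[ℂ] Fock q H where
  toLinearEquiv := LinearEquiv.ofLinearMap
    (secondQuantizationMap q V.toLinearIsometry).toLinearMap
    (secondQuantizationMap q V.symm.toLinearIsometry).toLinearMap
    (LinearMap.ext fun x => secondQuantizationMap_comp q _ _ (by simp) x)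
    (LinearMap.ext fun x => secondQuantizationMap_comp q _ _ (by simp) x)
  norm_map' x := norm_secondQuantizationMap q _ x

theorem secondQuantization_coe (V : H ≃ₗᵢ[ℂ] H) (x : PreFock q H) :
    secondQuantization q V x = (preSecondQuantization q V.toLinearIsometry x : PreFock q H) :=
  secondQuantizationMap_coe q _ x

theorem secondQuantization_vacuum (V : H ≃ₗᵢ[ℂ] H) :
    secondQuantization q V (vacuum q H) = vacuum q H := by
  rw [vacuum, tensor, secondQuantization_coe, preSecondQuantization_preTensor, List.map_nil]

theorem creator_coe (f : H) (x : PreFock q H) :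
    creator q f x = (preCreator q f x : PreFock q H) := by
  rw [creator, ContinuousLinearMap.completion_apply_coe]; rfl

theorem annihilator_coe (f : H) (x : PreFock q H) :
    annihilator q f x = (preAnnihilator q f x : PreFock q H) := by
  rw [annihilator, ContinuousLinearMap.completion_apply_coe]; rfl

theorem secondQuantization_creator (V : H ≃ₗᵢ[ℂ] H) (f : H) (x : Fock q H) :
    secondQuantization q V (creator q f x) = creator q (V f) (secondQuantization q V x) := by
  induction x using UniformSpace.Completion.induction_on with
  | hp => exact isClosed_eq (by fun_prop) (by fun_prop)
  | ih x =>
    rw [creator_coe, secondQuantization_coe, secondQuantization_coe, creator_coe]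
    congr 1
    induction x using preFock_induction with
    | h0 => simp
    | hadd x y hx hy => simp only [map_add, hx, hy]
    | hs c u => simp [preSecondQuantization_preTensor, preCreator_preTensor]

theorem inner_creator_left (f : H) (x y : Fock q H) :
    inner ℂ (creator q f x) y = inner ℂ x (annihilator q f y) := by
  induction x using UniformSpace.Completion.induction_on with
  | hp => exact isClosed_eq (by fun_prop) (by fun_prop)
  | ih x =>
    induction y using UniformSpace.Completion.induction_on with
    | hp => exact isClosed_eq (by fun_prop) (by fun_prop)
    | ih y => rw [inner_creator, annihilator_coe, UniformSpace.Completion.inner_coe]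

theorem annihilator_vacuum (f : H) : annihilator q f (vacuum q H) = 0 := by
  rw [vacuum, tensor, annihilator_coe, preAnnihilator_preTensor]
  simp [UniformSpace.Completion.coe_zero]

theorem norm_vacuum : ‖vacuum q H‖ = 1 := by
  rw [vacuum, tensor, UniformSpace.Completion.norm_coe, ← sq_eq_sq₀ (norm_nonneg _) zero_le_one,
    ← inner_self_eq_norm_sq (𝕜 := ℂ), inner_preTensor]
  simp [wordInner, inversions]

/-- The `q`-commutation relation, carried by continuity from the algebraic level to the completion.
It drives both the norm estimates and the Wick ordering below. -/
theorem annihilator_creator (f g : H) (x : Fock q H) :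
    annihilator q f (creator q g x) =
      inner ℂ f g • x + ((q : ℝ) : ℂ) • creator q g (annihilator q f x) := by
  induction x using UniformSpace.Completion.induction_on with
  | hp =>
    exact isClosed_eq ((annihilator q f).continuous.comp (creator q g).continuous)
      ((continuous_const_smul (inner ℂ f g)).add
        (((creator q g).continuous.comp (annihilator q f).continuous).fun_const_smul _))
  | ih x =>
    rw [creator_coe, annihilator_coe, annihilator_coe, creator_coe, preAnnihilator_preCreator,
      UniformSpace.Completion.coe_add, UniformSpace.Completion.coe_smul,
      UniformSpace.Completion.coe_smul]

/-- Adjoint of the intertwining relation for creators: testing against vectors in the range of the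
unitary, which is everything, moves the annihilator to the other side. -/
theorem secondQuantization_annihilator (V : H ≃ₗᵢ[ℂ] H) (f : H) (x : Fock q H) :
    secondQuantization q V (annihilator q f x) =
      annihilator q (V f) (secondQuantization q V x) := by
  refine ext_inner_left ℂ fun y => ?_
  obtain ⟨y, rfl⟩ := (secondQuantization q V).surjective y
  rw [LinearIsometryEquiv.inner_map_map, ← inner_creator_left, ← inner_creator_left,
    ← secondQuantization_creator, LinearIsometryEquiv.inner_map_map]

end SecondQuantization

/-! ### Permutation unitaries of `ℓ²(ℤ)`. -/

section EllTwo

/-- The permuted family is orthonormal with the same range, hence again a Hilbert basis; the inverse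
of its coordinate map is the required unitary, as `ℓ²(ℤ)` is itself the coordinate space. -/
theorem exists_permute_basis (σ : Equiv.Perm ℤ) :
    ∃ V : EllTwo ≃ₗᵢ[ℂ] EllTwo, ∀ j, V (e j) = e (σ j) := by
  let b : HilbertBasis ℤ ℂ EllTwo := HilbertBasis.ofRepr (LinearIsometryEquiv.refl ℂ _)
  have hb : ∀ j, b j = e j := fun j => by
    rw [← HilbertBasis.repr_symm_single]; rfl
  have ho : Orthonormal ℂ (b ∘ σ) := b.orthonormal.comp σ σ.injective
  have hr : Set.range (b ∘ σ) = Set.range b := σ.surjective.range_comp b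
  let c : HilbertBasis ℤ ℂ EllTwo := HilbertBasis.mk ho (by rw [hr, b.dense_span])
  refine ⟨c.repr.symm, fun j => ?_⟩
  rw [← hb (σ j)]
  have : c j = b (σ j) := by simp [c]
  rw [← this, ← HilbertBasis.repr_symm_single]
  rfl

theorem inner_e (i j : ℤ) : inner ℂ (e i) (e j) = if i = j then 1 else 0 := by
  rw [e, lp.inner_single_left, e, lp.single_apply]
  by_cases h : i = j
  · subst h; simp
  · simp [h]

/-- A unitary operator on `ℓ²(ℤ)` permuting the canonical basis. -/
def permuteBasis (σ : Equiv.Perm ℤ) : EllTwo ≃ₗᵢ[ℂ] EllTwo := (exists_permute_basis σ).choose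

theorem permuteBasis_e (σ : Equiv.Perm ℤ) (j : ℤ) : permuteBasis σ (e j) = e (σ j) :=
  (exists_permute_basis σ).choose_spec j

end EllTwo
-- Norm estimates from the `q`-commutation relations.
section CommutationRelations

open Filter Topology

variable {F : Type*} [NormedAddCommGroup F] [InnerProductSpace ℂ F] [CompleteSpace F]

theorem inner_star_apply (a : F →L[ℂ] F) (x y : F) : inner ℂ (star a x) y = inner ℂ x (a y) := by
  rw [ContinuousLinearMap.star_eq_adjoint, ContinuousLinearMap.adjoint_inner_left]

omit [CompleteSpace F] in
theorem mul_apply_eq_apply (a b : F →L[ℂ] F) (x : F) : (a * b) x = a (b x) := rfl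

/-- The left side is the quadratic form of `∑ a_k* a_k` at `x`. -/
theorem sum_norm_apply_sq_le {ι : Type*} (a : ι → F →L[ℂ] F) (t : Finset ι) (x : F) :
    ∑ k ∈ t, ‖a k x‖ ^ 2 ≤ ‖∑ k ∈ t, star (a k) * a k‖ * ‖x‖ ^ 2 := by
  have h : ((∑ k ∈ t, ‖a k x‖ ^ 2 : ℝ) : ℂ) = inner ℂ ((∑ k ∈ t, star (a k) * a k) x) x := by
    rw [sum_apply, sum_inner]
    rw [Complex.ofReal_sum]
    refine Finset.sum_congr rfl fun k _ => ?_
    rw [mul_apply_eq_apply, inner_star_apply, inner_self_eq_norm_sq_to_K]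
    push_cast
    rfl
  have h1 : ∑ k ∈ t, ‖a k x‖ ^ 2 = ‖inner ℂ ((∑ k ∈ t, star (a k) * a k) x) x‖ := by
    rw [← h, Complex.norm_real, Real.norm_of_nonneg (by positivity)]
  rw [h1]
  calc _ ≤ ‖(∑ k ∈ t, star (a k) * a k) x‖ * ‖x‖ := norm_inner_le_norm _ _
    _ ≤ (‖∑ k ∈ t, star (a k) * a k‖ * ‖x‖) * ‖x‖ := by
        gcongr; exact ContinuousLinearMap.le_opNorm _ _
    _ = _ := by ring

/-- Operators satisfying the `q`-commutation relations have a bounded number operator sum. -/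
theorem norm_sum_star_mul_self_le {ι : Type*} [DecidableEq ι] {q : ℝ} (hq : |q| < 1)
    (a : ι → F →L[ℂ] F)
    (ha : ∀ i j, a i * star (a j) = (if i = j then (1 : ℂ) else 0) • 1 + (q : ℂ) • (star (a j) * a i))
    (t : Finset ι) : ‖∑ k ∈ t, star (a k) * a k‖ ≤ (1 - |q|)⁻¹ := by
  -- The commutation relation expands `‖D x‖²` into `∑ ‖a_i x‖²` plus `q` times a double sum, the
  -- latter of size at most `‖D‖² ‖x‖²`. This yields `‖D‖² ≤ ‖D‖ + |q| ‖D‖²`, whence the bound.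
  set D := ∑ k ∈ t, star (a k) * a k with hD
  have h2 : ∀ x, ∑ i ∈ t, ∑ j ∈ t, ‖a j (a i x)‖ ^ 2 ≤ ‖D‖ ^ 2 * ‖x‖ ^ 2 := fun x => by
    calc _ ≤ ∑ i ∈ t, ‖D‖ * ‖a i x‖ ^ 2 := Finset.sum_le_sum fun i _ => sum_norm_apply_sq_le a t _
      _ = ‖D‖ * ∑ i ∈ t, ‖a i x‖ ^ 2 := by rw [Finset.mul_sum]
      _ ≤ ‖D‖ * (‖D‖ * ‖x‖ ^ 2) := by gcongr; exact sum_norm_apply_sq_le a t x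
      _ = _ := by ring
  have h3 : ∀ x, ‖∑ i ∈ t, ∑ j ∈ t, inner ℂ (a j (a i x)) (a i (a j x))‖ ≤ ‖D‖ ^ 2 * ‖x‖ ^ 2 := by
    intro x
    refine le_trans ?_ (h2 x)
    -- Symmetrizing in `i` and `j` makes the double sum dominate the cross terms termwise, by
    -- Cauchy–Schwarz and `2rs ≤ r² + s²`.
    have e : ∑ i ∈ t, ∑ j ∈ t, ‖a j (a i x)‖ ^ 2 =
        ∑ i ∈ t, ∑ j ∈ t, (‖a j (a i x)‖ ^ 2 + ‖a i (a j x)‖ ^ 2) / 2 := by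
      have := Finset.sum_comm (s := t) (t := t) (f := fun i j => ‖a j (a i x)‖ ^ 2)
      simp only [← Finset.sum_div, Finset.sum_add_distrib]
      linarith
    rw [e]
    refine (norm_sum_le _ _).trans (Finset.sum_le_sum fun i _ => (norm_sum_le _ _).trans
      (Finset.sum_le_sum fun j _ => (norm_inner_le_norm _ _).trans ?_))
    nlinarith [sq_nonneg (‖a j (a i x)‖ - ‖a i (a j x)‖)]
  have h4 : ∀ x, inner ℂ (D x) (D x) = ((∑ i ∈ t, ‖a i x‖ ^ 2 : ℝ) : ℂ) +
      (q : ℂ) * ∑ i ∈ t, ∑ j ∈ t, inner ℂ (a j (a i x)) (a i (a j x)) := by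
    intro x
    have e : ∀ i j, inner ℂ ((star (a i) * a i) x) ((star (a j) * a j) x) =
        (if i = j then inner ℂ (a i x) (a j x) else 0) +
          q * inner ℂ (a j (a i x)) (a i (a j x)) := by
      intro i j
      have := congrArg (fun T : F →L[ℂ] F => T (a j x)) (ha i j)
      simp only [mul_apply_eq_apply, add_apply,
        smul_apply, one_apply_eq_self] at this
      rw [mul_apply_eq_apply, inner_star_apply, mul_apply_eq_apply, this,
        inner_add_right, inner_smul_right, inner_smul_right, ← inner_conj_symm (a i x) (star (a j) _),
        inner_star_apply, inner_conj_symm]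
      split_ifs <;> simp
    rw [hD, sum_apply, sum_inner]
    simp only [inner_sum, e, Finset.sum_add_distrib, Finset.mul_sum]
    congr 1
    push_cast
    refine Finset.sum_congr rfl fun i hi => ?_
    rw [Finset.sum_ite_eq, if_pos hi, inner_self_eq_norm_sq_to_K]
    rfl
  have h5 : ∀ x, ‖D x‖ ^ 2 ≤ (‖D‖ + |q| * ‖D‖ ^ 2) * ‖x‖ ^ 2 := by
    intro x
    have e : ‖D x‖ ^ 2 = ‖inner ℂ (D x) (D x)‖ := by
      rw [inner_self_eq_norm_sq_to_K]; simp
    rw [e, h4]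
    refine (norm_add_le _ _).trans ?_
    rw [add_mul, mul_assoc, norm_mul, Complex.norm_real, Complex.norm_real,
      Real.norm_of_nonneg (by positivity), Real.norm_eq_abs]
    gcongr
    · exact sum_norm_apply_sq_le a t x
    · exact h3 x
  have h6 : ‖D‖ ^ 2 ≤ ‖D‖ + |q| * ‖D‖ ^ 2 := by
    have hn : 0 ≤ ‖D‖ + |q| * ‖D‖ ^ 2 := by positivity
    have : ‖D‖ ≤ Real.sqrt (‖D‖ + |q| * ‖D‖ ^ 2) := by
      refine ContinuousLinearMap.opNorm_le_bound _ (Real.sqrt_nonneg _) fun x => ?_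
      rw [← sq_le_sq₀ (norm_nonneg _) (by positivity), mul_pow, Real.sq_sqrt hn]
      exact h5 x
    rwa [Real.le_sqrt (norm_nonneg _) hn] at this
  have h7 : 0 < 1 - |q| := by linarith
  rw [← one_div, le_div_iff₀ h7]
  rcases (norm_nonneg D).eq_or_lt with h0 | h0
  · rw [← h0]; simp
  · nlinarith

/-- With `S` the sum, `‖S x‖² = ∑ ⟪T_k x, a_k S x⟫`; Cauchy–Schwarz over `k` and the bounded number
operator give `√card` in place of the trivial `card`. The absolute value on `C` matters only for
empty `t`, where `C` may be negative. -/
theorem norm_sum_star_mul_le {ι : Type*} [DecidableEq ι] {q : ℝ} (hq : |q| < 1)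
    (a : ι → F →L[ℂ] F)
    (ha : ∀ i j, a i * star (a j) = (if i = j then (1 : ℂ) else 0) • 1 + (q : ℂ) • (star (a j) * a i))
    (t : Finset ι) (T : ι → F →L[ℂ] F) {C : ℝ} (hT : ∀ k ∈ t, ‖T k‖ ≤ C) :
    ‖∑ k ∈ t, star (a k) * T k‖ ≤ Real.sqrt (1 - |q|)⁻¹ * Real.sqrt t.card * |C| := by
  have hB : 0 ≤ (1 - |q|)⁻¹ := inv_nonneg.mpr (by linarith)
  refine ContinuousLinearMap.opNorm_le_bound _ (by positivity) fun x => ?_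
  set S := ∑ k ∈ t, star (a k) * T k with hS
  have h1 : ‖S x‖ ^ 2 ≤ ∑ k ∈ t, ‖T k x‖ * ‖a k (S x)‖ := by
    have e : ‖S x‖ ^ 2 = ‖inner ℂ (S x) (S x)‖ := by
      rw [inner_self_eq_norm_sq_to_K]; simp
    rw [e]
    conv_lhs => rw [hS, sum_apply, sum_inner, ← sum_apply,
      ← hS]
    refine (norm_sum_le _ _).trans (Finset.sum_le_sum fun k _ => ?_)
    rw [mul_apply_eq_apply, inner_star_apply]
    exact norm_inner_le_norm _ _
  have h2 := Real.sum_mul_le_sqrt_mul_sqrt t (fun k => ‖T k x‖) (fun k => ‖a k (S x)‖)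
  have h3 : Real.sqrt (∑ k ∈ t, ‖T k x‖ ^ 2) ≤ Real.sqrt t.card * (|C| * ‖x‖) := by
    rw [← Real.sqrt_sq (show 0 ≤ |C| * ‖x‖ by positivity), ← Real.sqrt_mul (by positivity)]
    refine Real.sqrt_le_sqrt ?_
    rw [← nsmul_eq_mul]
    refine Finset.sum_le_card_nsmul _ _ _ fun k hk => ?_
    gcongr
    exact (ContinuousLinearMap.le_opNorm _ _).trans
      (mul_le_mul_of_nonneg_right ((hT k hk).trans (le_abs_self C)) (norm_nonneg x))
  have h4 : Real.sqrt (∑ k ∈ t, ‖a k (S x)‖ ^ 2) ≤ Real.sqrt (1 - |q|)⁻¹ * ‖S x‖ := by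
    rw [← Real.sqrt_sq (norm_nonneg (S x)), ← Real.sqrt_mul hB]
    refine Real.sqrt_le_sqrt ((sum_norm_apply_sq_le a t _).trans ?_)
    gcongr
    exact norm_sum_star_mul_self_le hq a ha t
  have h5 : ‖S x‖ ^ 2 ≤ (Real.sqrt t.card * (|C| * ‖x‖)) * (Real.sqrt (1 - |q|)⁻¹ * ‖S x‖) :=
    (h1.trans h2).trans (mul_le_mul h3 h4 (Real.sqrt_nonneg _) (by positivity))
  rcases (norm_nonneg (S x)).eq_or_lt with h0 | h0
  · rw [← h0]; positivity
  · nlinarith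

end CommutationRelations

/-! ### Norm convergence of Cesàro means of shifts. -/

section Mean

open Filter Topology

variable {F : Type*} [NormedAddCommGroup F] [InnerProductSpace ℂ F] [CompleteSpace F]

/-- Operators `l_j`, `j ∈ ℤ`, that satisfy the `q`-commutation relations, annihilate a unit
vector `ζ`, and are permuted by unitary operators fixing `ζ`. -/
structure IsExchangeableVacuum (q : ℝ) (l : ℤ → F →L[ℂ] F) (ζ : F)
    (U : Equiv.Perm ℤ → F ≃ₗᵢ[ℂ] F) : Prop where
  abs_lt_one : |q| < 1
  mul_star : ∀ i j, l i * star (l j) =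
    (if i = j then (1 : ℂ) else 0) • 1 + (q : ℂ) • (star (l j) * l i)
  apply_vacuum : ∀ j, l j ζ = 0
  norm_vacuum : ‖ζ‖ = 1
  map_vacuum : ∀ σ, U σ ζ = ζ
  conj : ∀ σ j, (U σ).conjStarAlgEquiv (l j) = l (σ j)

variable {q : ℝ} {l : ℤ → F →L[ℂ] F} {ζ : F} (U : Equiv.Perm ℤ → F ≃ₗᵢ[ℂ] F)

theorem norm_conjStarAlgEquiv (V : F ≃ₗᵢ[ℂ] F) (x : F →L[ℂ] F) : ‖V.conjStarAlgEquiv x‖ = ‖x‖ :=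
  NonUnitalStarAlgHom.norm_map V.conjStarAlgEquiv V.conjStarAlgEquiv.injective x

/-- The Cesàro means of the shifts of an operator. -/
def shiftMean (N : ℕ) : (F →L[ℂ] F) →ₗ[ℂ] (F →L[ℂ] F) where
  toFun x := (N : ℂ)⁻¹ •
    ∑ k ∈ Finset.range N, (U (Equiv.addRight (k : ℤ))).conjStarAlgEquiv x
  map_add' x y := by simp [Finset.sum_add_distrib]
  map_smul' c x := by simp [← Finset.smul_sum, smul_comm c]

theorem shiftMean_apply (N : ℕ) (x : F →L[ℂ] F) :
    shiftMean U N x = (N : ℂ)⁻¹ •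
      ∑ k ∈ Finset.range N, (U (Equiv.addRight (k : ℤ))).conjStarAlgEquiv x := rfl

theorem norm_shiftMean_le (N : ℕ) (x : F →L[ℂ] F) : ‖shiftMean U N x‖ ≤ ‖x‖ := by
  rw [shiftMean_apply, norm_smul, norm_inv, Complex.norm_natCast]
  have : ‖∑ k ∈ Finset.range N, (U (Equiv.addRight (k : ℤ))).conjStarAlgEquiv x‖ ≤ N * ‖x‖ := by
    refine (norm_sum_le _ _).trans ?_
    simp [norm_conjStarAlgEquiv]
  rcases N.eq_zero_or_pos with rfl | hN
  · simp
  · rw [inv_mul_le_iff₀ (by exact_mod_cast hN)]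
    exact this

theorem shiftMean_star (N : ℕ) (x : F →L[ℂ] F) :
    shiftMean U N (star x) = star (shiftMean U N x) := by
  simp only [shiftMean_apply, map_star, star_smul, star_sum, star_inv₀, star_natCast]

/-- The operators whose Cesàro means converge in norm to their expectation in `ζ`. -/
def meanErgodic (ζ : F) : Submodule ℂ (F →L[ℂ] F) where
  carrier := {x | Tendsto (fun N => shiftMean U N x) atTop (𝓝 ((inner ℂ ζ (x ζ) : ℂ) • 1))}
  add_mem' {x y} hx hy := by
    simpa [add_smul, inner_add_right] using Tendsto.add hx hy
  zero_mem' := by simp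
  smul_mem' c x hx := by
    simpa [smul_smul, inner_smul_right] using Tendsto.const_smul hx c

theorem mem_meanErgodic {x : F →L[ℂ] F} : x ∈ meanErgodic U ζ ↔
    Tendsto (fun N => shiftMean U N x) atTop (𝓝 ((inner ℂ ζ (x ζ) : ℂ) • 1)) := Iff.rfl

/-- The means are linear contractions, hence equicontinuous, and the prospective limit depends
continuously on the operator. This is what extends convergence from the generated `⋆`-algebra to its
norm closure. -/
theorem isClosed_meanErgodic : IsClosed (meanErgodic U ζ : Set (F →L[ℂ] F)) := by
  refine Equicontinuous.isClosed_setOfPred_tendsto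
    (Metric.equicontinuous_of_continuity_modulus id tendsto_id _ fun x y N => ?_) (by fun_prop)
  rw [dist_eq_norm, dist_eq_norm, ← map_sub]
  exact norm_shiftMean_le U N _

theorem star_mem_meanErgodic {x : F →L[ℂ] F} (hx : x ∈ meanErgodic U ζ) :
    star x ∈ meanErgodic U ζ := by
  rw [mem_meanErgodic] at hx ⊢
  simp only [shiftMean_star]
  convert hx.star using 2
  rw [star_smul, star_one, RCLike.star_def, inner_conj_symm, ← inner_star_apply, star_star]

namespace IsExchangeableVacuum

variable {U}

/-- The `k`-th shift is `l_{j+k}† v_k` with `‖v_k‖ = ‖v‖`, so the sum of `N` shifts is `O(√N)` and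
the mean tends to zero; the vacuum expectation also vanishes, since `l_j ζ = 0`. The factor `v` is
any bounded operator, so nothing about the rest of a word has to be known. -/
theorem star_mul_mem_meanErgodic (h : IsExchangeableVacuum q l ζ U) (j : ℤ) (v : F →L[ℂ] F) :
    star (l j) * v ∈ meanErgodic U ζ := by
  have h0 : inner ℂ ζ ((star (l j) * v) ζ) = (0 : ℂ) := by
    rw [mul_apply_eq_apply, ← inner_conj_symm, inner_star_apply, h.apply_vacuum]
    simp
  rw [mem_meanErgodic, h0, zero_smul, tendsto_zero_iff_norm_tendsto_zero]
  set B := Real.sqrt (1 - |q|)⁻¹ with hB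
  have hb : ∀ N, ‖shiftMean U N (star (l j) * v)‖ ≤ (B * |‖v‖|) * (Real.sqrt N)⁻¹ := by
    intro N
    have e : ∀ k : ℕ, (U (Equiv.addRight (k : ℤ))).conjStarAlgEquiv (star (l j) * v) =
        star (l (j + k)) * (U (Equiv.addRight (k : ℤ))).conjStarAlgEquiv v := by
      intro k
      rw [map_mul, map_star, h.conj]
      rfl
    have := norm_sum_star_mul_le h.abs_lt_one (fun k : ℕ => l (j + k))
      (fun i k => by rw [h.mul_star]; simp) (Finset.range N)
      (fun k => (U (Equiv.addRight (k : ℤ))).conjStarAlgEquiv v)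
      (C := ‖v‖) fun k _ => (norm_conjStarAlgEquiv _ v).le
    rw [shiftMean_apply, norm_smul, norm_inv, Complex.norm_natCast]
    simp only [e]
    rw [Finset.card_range, ← hB] at this
    rcases N.eq_zero_or_pos with rfl | hN
    · simp
    · have hN' : (0 : ℝ) < N := by exact_mod_cast hN
      have hs : Real.sqrt N * Real.sqrt N = N := Real.mul_self_sqrt hN'.le
      have hs' : 0 < Real.sqrt N := Real.sqrt_pos.mpr hN'
      rw [inv_mul_le_iff₀ hN']
      refine this.trans_eq ?_
      rw [show (N : ℝ) * (B * |‖v‖| * (Real.sqrt N)⁻¹) =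
        (Real.sqrt N * Real.sqrt N) * (B * |‖v‖| * (Real.sqrt N)⁻¹) by rw [hs]]
      field_simp
  refine squeeze_zero (fun _ => norm_nonneg _) hb ?_
  rw [← mul_zero (B * |‖v‖|)]
  exact ((tendsto_inv_atTop_zero.comp Real.tendsto_sqrt_atTop).comp
    tendsto_natCast_atTop_atTop).const_mul _

theorem mul_mem_meanErgodic (h : IsExchangeableVacuum q l ζ U) (j : ℤ) (v : F →L[ℂ] F) :
    v * l j ∈ meanErgodic U ζ := by
  have := star_mem_meanErgodic U (h.star_mul_mem_meanErgodic j (star v))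
  rwa [star_mul, star_star, star_star] at this

theorem one_mem_meanErgodic (h : IsExchangeableVacuum q l ζ U) : 1 ∈ meanErgodic U ζ := by
  rw [mem_meanErgodic]
  refine tendsto_const_nhds.congr' ?_
  filter_upwards [eventually_gt_atTop 0] with N hN
  have hN' : (N : ℂ) ≠ 0 := by exact_mod_cast hN.ne'
  rw [shiftMean_apply, one_apply_eq_self, inner_self_eq_norm_sq_to_K, h.norm_vacuum]
  simp [← Nat.cast_smul_eq_nsmul ℂ, smul_smul, hN']

end IsExchangeableVacuum

/-- Linear combinations of Wick-ordered products of the operators `l j` and their adjoints. -/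
inductive IsWickOrdered (l : ℤ → F →L[ℂ] F) : (F →L[ℂ] F) → Prop
  | one : IsWickOrdered l 1
  | add {x y} : IsWickOrdered l x → IsWickOrdered l y → IsWickOrdered l (x + y)
  | smul (c : ℂ) {x} : IsWickOrdered l x → IsWickOrdered l (c • x)
  | star_mul (j : ℤ) {x} : IsWickOrdered l x → IsWickOrdered l (star (l j) * x)
  | mul (j : ℤ) {x} : IsWickOrdered l x → IsWickOrdered l (x * l j)

namespace IsExchangeableVacuum

variable {U}

/-- An annihilator on the left is pushed rightwards: passing a creator costs a factor `q` and a
contraction term in which both disappear. -/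
theorem isWickOrdered_mul (h : IsExchangeableVacuum q l ζ U) {x : F →L[ℂ] F}
    (hx : IsWickOrdered l x) (i : ℤ) : IsWickOrdered l (l i * x) := by
  induction hx with
  | one => rw [mul_one, ← one_mul (l i)]; exact IsWickOrdered.one.mul i
  | add _ _ hx hy => rw [mul_add]; exact hx.add hy
  | smul c _ hx => rw [mul_smul_comm]; exact hx.smul c
  | star_mul j hx hx' =>
    rw [← mul_assoc, h.mul_star, add_mul, smul_mul_assoc, one_mul, smul_mul_assoc, mul_assoc]
    exact (hx.smul _).add ((hx'.star_mul j).smul _)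
  | mul j _ hx => rw [← mul_assoc]; exact hx.mul j

/-- A Wick-ordered word other than `1` begins with a creator or ends with an annihilator, and one
such factor suffices. -/
theorem mem_meanErgodic_of_isWickOrdered (h : IsExchangeableVacuum q l ζ U) {x : F →L[ℂ] F}
    (hx : IsWickOrdered l x) : x ∈ meanErgodic U ζ := by
  induction hx with
  | one => exact h.one_mem_meanErgodic
  | add _ _ hx hy => exact add_mem hx hy
  | smul c _ hx => exact Submodule.smul_mem _ c hx
  | star_mul j _ _ => exact h.star_mul_mem_meanErgodic j _
  | mul j _ _ => exact h.mul_mem_meanErgodic j _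

/-- Acting on an arbitrary Wick-ordered `y` makes the claim stable under products, and including
`star x` makes it stable under adjoints; `y = 1` is the case of interest. -/
theorem isWickOrdered_mul_of_mem_adjoin (h : IsExchangeableVacuum q l ζ U) {x : F →L[ℂ] F}
    (hx : x ∈ StarAlgebra.adjoin ℂ (Set.range l)) :
    ∀ y, IsWickOrdered l y → IsWickOrdered l (x * y) ∧ IsWickOrdered l (star x * y) := by
  induction hx using StarAlgebra.adjoin_induction with
  | mem x hx =>
    obtain ⟨j, rfl⟩ := hx
    exact fun y hy => ⟨h.isWickOrdered_mul hy j, hy.star_mul j⟩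
  | algebraMap c =>
    intro y hy
    simp only [Algebra.algebraMap_eq_smul_one, star_smul, star_one, smul_mul_assoc, one_mul]
    exact ⟨hy.smul c, hy.smul _⟩
  | add a b _ _ ha hb =>
    intro y hy
    rw [star_add, add_mul, add_mul]
    exact ⟨(ha y hy).1.add (hb y hy).1, (ha y hy).2.add (hb y hy).2⟩
  | mul a b _ _ ha hb =>
    intro y hy
    rw [star_mul, mul_assoc, mul_assoc]
    exact ⟨(ha _ (hb y hy).1).1, (hb _ (ha y hy).2).2⟩
  | star a _ ha =>
    intro y hy
    rw [star_star]
    exact (ha y hy).symm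

theorem mem_meanErgodic_of_mem_cstarGen (h : IsExchangeableVacuum q l ζ U) {x : F →L[ℂ] F}
    (hx : x ∈ cstarGen l) : x ∈ meanErgodic U ζ := by
  have hs : (StarAlgebra.adjoin ℂ (Set.range l) : Set (F →L[ℂ] F)) ⊆ meanErgodic U ζ :=
    fun y hy => by
      have := h.mem_meanErgodic_of_isWickOrdered (h.isWickOrdered_mul_of_mem_adjoin hy 1 .one).1
      rwa [mul_one] at this
  exact closure_minimal hs (isClosed_meanErgodic U) hx

end IsExchangeableVacuum

theorem cstarGen_le {a b : ℤ → F →L[ℂ] F} (h : ∀ j, a j ∈ cstarGen b) : cstarGen a ≤ cstarGen b := by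
  refine StarSubalgebra.topologicalClosure_minimal (StarAlgebra.adjoin_le ?_)
    (StarSubalgebra.isClosed_topologicalClosure _)
  rintro _ ⟨j, rfl⟩
  exact h j

end Mean
-- Construction of the index actions and determination of the invariant states.
section Action

open Filter Topology

/-- Each new point `a` is corrected by the transposition of `σ a` and `g a`; injectivity of `σ` and
`g` keeps it away from the values already prescribed. -/
theorem exists_mem_finitePermutations {g : ℤ → ℤ} (hg : Function.Injective g) (t : Finset ℤ) :
    ∃ σ : Equiv.Perm ℤ, (⇑σ : Function.End ℤ) ∈ finitePermutations ∧ ∀ j ∈ t, σ j = g j := by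
  induction t using Finset.induction_on with
  | empty => exact ⟨1, finitePermutations.one_mem, by simp⟩
  | insert a t ha ih =>
    obtain ⟨σ, hσ, h⟩ := ih
    have hs : (⇑(Equiv.swap (σ a) (g a)) : Function.End ℤ) ∈ finitePermutations := by
      refine ⟨Equiv.bijective _, (Set.toFinite {σ a, g a}).subset fun k hk => ?_⟩
      by_contra hn
      simp only [Set.mem_insert_iff, Set.mem_singleton_iff, not_or] at hn
      exact hk (Equiv.swap_apply_of_ne_of_ne hn.1 hn.2)
    refine ⟨Equiv.swap (σ a) (g a) * σ, ?_, fun j hj => ?_⟩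
    · have := finitePermutations.mul_mem hs hσ
      exact this
    rw [Equiv.Perm.mul_apply]
    rcases Finset.mem_insert.mp hj with rfl | hj
    · exact Equiv.swap_apply_left _ _
    · have hne : j ≠ a := fun e => ha (e ▸ hj)
      rw [Equiv.swap_apply_of_ne_of_ne (fun e => hne (σ.injective e))
        (by rw [h j hj]; exact fun e => hne (hg e)), h j hj]

theorem isClosed_setOf_cauchySeq {A : Type*} [PseudoMetricSpace A] (Φ : ℕ → A → A)
    (h : ∀ n x y, dist (Φ n x) (Φ n y) ≤ dist x y) : IsClosed {x | CauchySeq fun n => Φ n x} := by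
  refine isClosed_of_closure_subset fun x hx => ?_
  rw [Set.mem_ofPred_eq, Metric.cauchySeq_iff']
  intro ε hε
  obtain ⟨y, hy, hxy⟩ := Metric.mem_closure_iff.mp hx (ε / 3) (by positivity)
  obtain ⟨N, hN⟩ := Metric.cauchySeq_iff'.mp hy (ε / 3) (by positivity)
  refine ⟨N, fun n hn => ?_⟩
  have h1 := h n x y
  have h2 := h N y x
  have h3 := dist_triangle4 (Φ n x) (Φ n y) (Φ N y) (Φ N x)
  have h4 := hN n hn
  rw [dist_comm y x] at h2
  linarith

variable {F : Type*} [NormedAddCommGroup F] [InnerProductSpace ℂ F] [CompleteSpace F]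
  {a : ℤ → F →L[ℂ] F} {U : Equiv.Perm ℤ → F ≃ₗᵢ[ℂ] F}

theorem isClosed_cstarGen (a : ℤ → F →L[ℂ] F) : IsClosed (cstarGen a : Set (F →L[ℂ] F)) :=
  StarSubalgebra.isClosed_topologicalClosure _

theorem continuous_conjStarAlgEquiv (V : F ≃ₗᵢ[ℂ] F) : Continuous V.conjStarAlgEquiv :=
  AddMonoidHomClass.continuous_of_bound V.conjStarAlgEquiv 1 fun x => by
    rw [one_mul, norm_conjStarAlgEquiv]

theorem conjStarAlgEquiv_mem_cstarGen (hU : ∀ σ j, (U σ).conjStarAlgEquiv (a j) = a (σ j))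
    (σ : Equiv.Perm ℤ) {x : F →L[ℂ] F} (hx : x ∈ cstarGen a) :
    (U σ).conjStarAlgEquiv x ∈ cstarGen a := by
  have hs : (StarAlgebra.adjoin ℂ (Set.range a) : Set (F →L[ℂ] F)) ⊆
      (U σ).conjStarAlgEquiv ⁻¹' cstarGen a := by
    intro y hy
    induction hy using StarAlgebra.adjoin_induction with
    | mem y hy =>
      obtain ⟨j, rfl⟩ := hy
      rw [Set.mem_preimage, hU]
      exact (gen a (σ j)).2
    | algebraMap c =>
      rw [Set.mem_preimage, Algebra.algebraMap_eq_smul_one, map_smul, map_one]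
      exact (cstarGen a).smul_mem (one_mem _) c
    | add y z _ _ hy hz => rw [Set.mem_preimage, map_add]; exact add_mem hy hz
    | mul y z _ _ hy hz => rw [Set.mem_preimage, map_mul]; exact mul_mem hy hz
    | star y _ hy => rw [Set.mem_preimage, map_star]; exact star_mem hy
  exact closure_minimal hs ((isClosed_cstarGen a).preimage (continuous_conjStarAlgEquiv _)) hx

/-- On the `⋆`-algebra generated by the `a j` the sequence is eventually constant, as each element
involves finitely many indices. Conjugations are isometric, so the Cauchy property passes to the
closure. -/
theorem exists_tendsto_conjStarAlgEquiv (hU : ∀ σ j, (U σ).conjStarAlgEquiv (a j) = a (σ j))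
    {g : ℤ → ℤ} {σ : ℕ → Equiv.Perm ℤ} (hσ : ∀ j, ∀ᶠ n in atTop, σ n j = g j)
    {x : F →L[ℂ] F} (hx : x ∈ cstarGen a) :
    ∃ y, Tendsto (fun n => (U (σ n)).conjStarAlgEquiv x) atTop (𝓝 y) := by
  have hs : ∀ y ∈ StarAlgebra.adjoin ℂ (Set.range a),
      ∃ z, ∀ᶠ n in atTop, (U (σ n)).conjStarAlgEquiv y = z := by
    intro y hy
    induction hy using StarAlgebra.adjoin_induction with
    | mem y hy =>
      obtain ⟨j, rfl⟩ := hy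
      exact ⟨a (g j), (hσ j).mono fun n hn => by rw [hU, hn]⟩
    | algebraMap c =>
      exact ⟨c • 1, .of_forall fun n => by
        rw [Algebra.algebraMap_eq_smul_one, map_smul, map_one]⟩
    | add y z _ _ hy hz =>
      obtain ⟨y', hy⟩ := hy
      obtain ⟨z', hz⟩ := hz
      exact ⟨y' + z', (hy.and hz).mono fun n hn => by rw [map_add, hn.1, hn.2]⟩
    | mul y z _ _ hy hz =>
      obtain ⟨y', hy⟩ := hy
      obtain ⟨z', hz⟩ := hz
      exact ⟨y' * z', (hy.and hz).mono fun n hn => by rw [map_mul, hn.1, hn.2]⟩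
    | star y _ hy =>
      obtain ⟨y', hy⟩ := hy
      exact ⟨star y', hy.mono fun n hn => by rw [map_star, hn]⟩
  have hc : IsClosed {x | CauchySeq fun n => (U (σ n)).conjStarAlgEquiv x} :=
    isClosed_setOf_cauchySeq (fun n => (U (σ n)).conjStarAlgEquiv) fun n x y => by
      rw [dist_eq_norm, dist_eq_norm, ← map_sub, norm_conjStarAlgEquiv]
  refine cauchySeq_tendsto_of_complete (closure_minimal (fun y hy => ?_) hc hx)
  obtain ⟨z, hz⟩ := hs y hy
  exact (tendsto_const_nhds.congr' (hz.mono fun _ h => h.symm)).cauchySeq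

theorem exists_starAlgHom_tendsto (hU : ∀ σ j, (U σ).conjStarAlgEquiv (a j) = a (σ j))
    {g : ℤ → ℤ} {σ : ℕ → Equiv.Perm ℤ} (hσ : ∀ j, ∀ᶠ n in atTop, σ n j = g j) :
    ∃ α : cstarGen a →⋆ₐ[ℂ] cstarGen a,
      ∀ x : cstarGen a, Tendsto (fun n => (U (σ n)).conjStarAlgEquiv (x : F →L[ℂ] F)) atTop
        (𝓝 (α x : F →L[ℂ] F)) := by
  choose f hf using fun x : cstarGen a => exists_tendsto_conjStarAlgEquiv hU hσ x.2
  have hmem : ∀ x, f x ∈ cstarGen a := fun x => (isClosed_cstarGen a).mem_of_tendsto (hf x)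
    (.of_forall fun n => conjStarAlgEquiv_mem_cstarGen hU _ x.2)
  refine ⟨{
    toFun := fun x => ⟨f x, hmem x⟩
    map_one' := ?_
    map_mul' := ?_
    map_zero' := ?_
    map_add' := ?_
    commutes' := ?_
    map_star' := ?_ }, hf⟩
  · refine Subtype.ext (tendsto_nhds_unique (hf 1) ?_)
    simp only [OneMemClass.coe_one, map_one]
    exact tendsto_const_nhds
  · refine fun x y => Subtype.ext (tendsto_nhds_unique (hf _) ?_)
    simp only [MulMemClass.coe_mul, map_mul]
    exact (hf x).mul (hf y)
  · refine Subtype.ext (tendsto_nhds_unique (hf 0) ?_)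
    simp only [ZeroMemClass.coe_zero, map_zero]
    exact tendsto_const_nhds
  · refine fun x y => Subtype.ext (tendsto_nhds_unique (hf _) ?_)
    simp only [AddMemClass.coe_add, map_add]
    exact (hf x).add (hf y)
  · refine fun c => Subtype.ext (tendsto_nhds_unique (hf _) ?_)
    have : ∀ V : F ≃ₗᵢ[ℂ] F, V.conjStarAlgEquiv (algebraMap ℂ (cstarGen a) c : F →L[ℂ] F) =
        (algebraMap ℂ (cstarGen a) c : F →L[ℂ] F) := fun V => by
      rw [show (algebraMap ℂ (cstarGen a) c : F →L[ℂ] F) = algebraMap ℂ _ c from rfl, Algebra.algebraMap_eq_smul_one, map_smul, map_one]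
    simp only [this]
    exact tendsto_const_nhds
  · refine fun x => Subtype.ext (tendsto_nhds_unique (hf _) ?_)
    simp only [StarMemClass.coe_star, map_star]
    exact (hf x).star

/-- Only injectivity of the index maps is needed. The approximating finite permutations are kept in
the conclusion because they transfer invariance between the monoids. -/
theorem exists_indexAction (hU : ∀ σ j, (U σ).conjStarAlgEquiv (a j) = a (σ j))
    (M : Submonoid (Function.End ℤ)) (hM : ∀ g ∈ M, Function.Injective g) :
    ∃ α : IndexAction M a, ∀ g : M, ∃ σ : ℕ → Equiv.Perm ℤ,
      (∀ n, (⇑(σ n) : Function.End ℤ) ∈ finitePermutations) ∧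
      ∀ x : cstarGen a, Tendsto (fun n => (U (σ n)).conjStarAlgEquiv (x : F →L[ℂ] F)) atTop
        (𝓝 (α.toHom g x : F →L[ℂ] F)) := by
  have key : ∀ g : M, ∃ α : cstarGen a →⋆ₐ[ℂ] cstarGen a,
      (∀ j, α (gen a j) = gen a ((g : Function.End ℤ) j)) ∧ ∃ σ : ℕ → Equiv.Perm ℤ,
      (∀ n, (⇑(σ n) : Function.End ℤ) ∈ finitePermutations) ∧
      ∀ x : cstarGen a, Tendsto (fun n => (U (σ n)).conjStarAlgEquiv (x : F →L[ℂ] F)) atTop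
        (𝓝 (α x : F →L[ℂ] F)) := by
    intro g
    choose σ hσ hσ' using fun n : ℕ =>
      exists_mem_finitePermutations (hM g g.2) (Finset.Icc (-(n : ℤ)) n)
    have hσ'' : ∀ j, ∀ᶠ n in atTop, σ n j = (g : Function.End ℤ) j := by
      intro j
      filter_upwards [eventually_ge_atTop j.natAbs] with n hn
      exact hσ' n j (by rw [Finset.mem_Icc]; omega)
    obtain ⟨α, hα⟩ := exists_starAlgHom_tendsto hU hσ''
    refine ⟨α, fun j => Subtype.ext (tendsto_nhds_unique (hα (gen a j)) ?_), σ, hσ, hα⟩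
    refine tendsto_const_nhds.congr' ((hσ'' j).mono fun n hn => ?_)
    change _ = (U (σ n)).conjStarAlgEquiv (a j)
    rw [hU, hn]
    rfl
  choose α hα hσ using key
  -- The monoid laws hold on generators, and a `⋆`-endomorphism is determined there.
  refine ⟨⟨⟨⟨α, ?_⟩, ?_⟩, hα⟩, hσ⟩
  · exact starAlgHom_ext_gen a _ _ fun j => hα 1 j
  · intro g h
    refine starAlgHom_ext_gen a _ _ fun j => ?_
    rw [hα]
    change _ = α g (α h (gen a j))
    rw [hα, hα]
    rfl

theorem continuous_starAlgHom_cstarGen (χ : cstarGen a →⋆ₐ[ℂ] cstarGen a) : Continuous χ := by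
  have : IsClosed (cstarGen a : Set (F →L[ℂ] F)) := isClosed_cstarGen a
  let _ : CStarAlgebra (cstarGen a) := StarSubalgebra.cstarAlgebra (cstarGen a)
  exact AddMonoidHomClass.continuous_of_bound χ 1 fun x => by
    simpa using NonUnitalStarAlgHom.norm_apply_le χ x

theorem IndexAction.toHom_eq_conj (hU : ∀ σ j, (U σ).conjStarAlgEquiv (a j) = a (σ j))
    {M : Submonoid (Function.End ℤ)} (α : IndexAction M a) (σ : Equiv.Perm ℤ)
    (hσ : (⇑σ : Function.End ℤ) ∈ M) (x : cstarGen a) :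
    (α.toHom ⟨⇑σ, hσ⟩ x : F →L[ℂ] F) = (U σ).conjStarAlgEquiv (x : F →L[ℂ] F) := by
  have hc : IsClosed {x : cstarGen a | (α.toHom ⟨⇑σ, hσ⟩ x : F →L[ℂ] F) =
      (U σ).conjStarAlgEquiv (x : F →L[ℂ] F)} :=
    isClosed_eq (continuous_subtype_val.comp (continuous_starAlgHom_cstarGen _))
      ((continuous_conjStarAlgEquiv _).comp continuous_subtype_val)
  -- A constant sequence turns conjugation by `U σ` into an endomorphism of the generated algebra,
  -- to which uniqueness on generators applies.
  obtain ⟨β, hβ⟩ := exists_starAlgHom_tendsto hU (g := σ) (σ := fun _ => σ)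
    (fun j => .of_forall fun _ => rfl)
  have hβ' : ∀ x : cstarGen a, (β x : F →L[ℂ] F) = (U σ).conjStarAlgEquiv (x : F →L[ℂ] F) :=
    fun x => tendsto_nhds_unique (hβ x) tendsto_const_nhds
  have e : α.toHom ⟨⇑σ, hσ⟩ = β := starAlgHom_ext_gen a _ _ fun j => ?_
  · rw [← hβ', e]
  rw [α.map_gen]
  refine Subtype.ext ?_
  rw [hβ']
  exact (hU σ j).symm

/-- In the spectral order the nonnegative elements are the `star y * y`, so a state is a positive
functional on a C⋆-algebra, and these are bounded. -/
theorem IsState.continuous {φ : cstarGen a →ₗ[ℂ] ℂ} (hφ : IsState φ) : Continuous φ := by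
  have : IsClosed (cstarGen a : Set (F →L[ℂ] F)) := isClosed_cstarGen a
  let _ : CStarAlgebra (cstarGen a) := StarSubalgebra.cstarAlgebra (cstarGen a)
  let _ := CStarAlgebra.spectralOrder (cstarGen a)
  have := CStarAlgebra.spectralOrderedRing (cstarGen a)
  obtain ⟨C, hC⟩ := (PositiveLinearMap.mk₀ φ fun x hx => by
    obtain ⟨y, rfl⟩ := CStarAlgebra.nonneg_iff_eq_star_mul_self.mp hx
    exact hφ.nonneg y).exists_norm_apply_le
  exact AddMonoidHomClass.continuous_of_bound φ C hC

theorem isState_vectorFunctional (A : StarSubalgebra ℂ (F →L[ℂ] F)) {ζ : F} (hζ : ‖ζ‖ = 1) :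
    IsState (vectorFunctional A ζ) where
  nonneg x := by
    change 0 ≤ inner ℂ ζ ((star (x : F →L[ℂ] F) * (x : F →L[ℂ] F)) ζ)
    rw [mul_apply_eq_apply, ← inner_star_apply, star_star]
    rw [inner_self_eq_norm_sq_to_K]
    exact RCLike.ofReal_pow (K := ℂ) _ 2 ▸ RCLike.ofReal_nonneg.mpr (sq_nonneg _)
  map_one := by
    change inner ℂ ζ ζ = (1 : ℂ)
    rw [inner_self_eq_norm_sq_to_K, hζ]
    simp

theorem inner_conjStarAlgEquiv_apply {V : F ≃ₗᵢ[ℂ] F} {ζ : F} (hV : V ζ = ζ) (x : F →L[ℂ] F) :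
    (inner ℂ ζ (V.conjStarAlgEquiv x ζ) : ℂ) = inner ℂ ζ (x ζ) := by
  rw [LinearIsometryEquiv.conjStarAlgEquiv_apply_apply]
  nth_rw 1 [← hV]
  rw [LinearIsometryEquiv.inner_map_map, V.symm_apply_eq.mpr hV.symm]

variable {q : ℝ} {l : ℤ → F →L[ℂ] F} {ζ : F}

/-- The state is constant along the means of `x`, which converge in norm to a scalar multiple of
`1`. Invariance is phrased through conjugation by shift unitaries rather than an action, so that it
can be fed from any of the monoids. -/
theorem IsExchangeableVacuum.eq_vectorFunctional (h : IsExchangeableVacuum q l ζ U)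
    (hU : ∀ σ j, (U σ).conjStarAlgEquiv (a j) = a (σ j)) (ha : ∀ j, a j ∈ cstarGen l)
    {φ : cstarGen a →ₗ[ℂ] ℂ} (hφ : IsState φ)
    (hinv : ∀ (k : ℕ) (x y : cstarGen a), (y : F →L[ℂ] F) =
      (U (Equiv.addRight (k : ℤ))).conjStarAlgEquiv (x : F →L[ℂ] F) → φ y = φ x) :
    φ = vectorFunctional (cstarGen a) ζ := by
  ext x
  -- Shifts and means are formed inside the generated algebra, where the state is defined.
  let w : ℕ → cstarGen a := fun k =>
    ⟨_, conjStarAlgEquiv_mem_cstarGen hU (Equiv.addRight (k : ℤ)) x.2⟩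
  let y : ℕ → cstarGen a := fun N => (N : ℂ)⁻¹ • ∑ k ∈ Finset.range N, w k
  have hy : ∀ N, (y N : F →L[ℂ] F) = shiftMean U N x := fun N => by
    rw [shiftMean_apply]
    simp only [y, w, SetLike.val_smul, AddSubmonoidClass.coe_finsetSum]
  have hlim : Tendsto y atTop (𝓝 ((inner ℂ ζ ((x : F →L[ℂ] F) ζ) : ℂ) • 1)) := by
    rw [tendsto_subtype_rng]
    simp only [hy]
    exact h.mem_meanErgodic_of_mem_cstarGen (cstarGen_le ha x.2)
  have hφy : ∀ᶠ N in atTop, φ (y N) = φ x := by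
    filter_upwards [eventually_gt_atTop 0] with N hN
    have hN' : (N : ℂ) ≠ 0 := by exact_mod_cast hN.ne'
    simp [y, hinv _ x (w _) rfl, hN']
  have h1 := (hφ.continuous.tendsto _).comp hlim
  rw [map_smul, hφ.map_one, smul_eq_mul, mul_one] at h1
  exact (tendsto_nhds_unique h1 (tendsto_const_nhds.congr' (hφy.mono fun _ h => h.symm))).symm

theorem addRight_mem_shifts (k : ℤ) : (⇑(Equiv.addRight k) : Function.End ℤ) ∈ shifts :=
  ⟨k, fun _ => rfl⟩

theorem IsExchangeableVacuum.exists_invariantStates_eq (h : IsExchangeableVacuum q l ζ U)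
    (hU : ∀ σ j, (U σ).conjStarAlgEquiv (a j) = a (σ j)) (ha : ∀ j, a j ∈ cstarGen l)
    (M : Submonoid (Function.End ℤ)) (hM : ∀ g ∈ M, Function.Injective g)
    (hM' : finitePermutations ≤ M ∨ shifts ≤ M) :
    ∃ α : IndexAction M a, α.invariantStates = {vectorFunctional (cstarGen a) ζ} := by
  obtain ⟨α, hα⟩ := exists_indexAction hU M hM
  refine ⟨α, Set.Subset.antisymm ?_ ?_⟩
  · rintro φ ⟨hφ, hinv⟩
    refine h.eq_vectorFunctional hU ha hφ fun k x y hy => ?_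
    rcases hM' with hP | hZ
    -- A shift is not a finite permutation, but its endomorphism is a pointwise norm limit of
    -- conjugations by finite permutations, so a continuous symmetric state is shift-invariant.
    · obtain ⟨β, hβ⟩ := exists_indexAction hU shifts (by
        rintro g ⟨n, hn⟩ i j hij
        rw [hn, hn] at hij
        exact add_right_cancel hij)
      obtain ⟨σ, hσ, hlim⟩ := hβ ⟨_, addRight_mem_shifts k⟩
      have hlim := hlim x
      rw [β.toHom_eq_conj hU, ← hy] at hlim
      have hlim' : Tendsto (fun n => α.toHom ⟨⇑(σ n), hP (hσ n)⟩ x) atTop (𝓝 y) := by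
        rw [tendsto_subtype_rng]
        simpa only [α.toHom_eq_conj hU] using hlim
      have := (hφ.continuous.tendsto _).comp hlim'
      refine tendsto_nhds_unique this (tendsto_const_nhds.congr fun n => ?_)
      exact (hinv _ x).symm
    · rw [← hinv ⟨_, hZ (addRight_mem_shifts k)⟩ x]
      congr 1
      exact Subtype.ext (hy.trans (α.toHom_eq_conj hU _ _ x).symm)
  · rintro _ rfl
    refine ⟨isState_vectorFunctional _ h.norm_vacuum, fun g x => ?_⟩
    -- Every approximating unitary fixes `ζ`, so the vector functional is unchanged along the
    -- sequence and hence at its limit.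
    obtain ⟨σ, -, hlim⟩ := hα g
    have hc : Continuous fun y : F →L[ℂ] F => (inner ℂ ζ (y ζ) : ℂ) := by fun_prop
    refine tendsto_nhds_unique ((hc.tendsto _).comp (hlim x)) (tendsto_const_nhds.congr fun n => ?_)
    exact (inner_conjStarAlgEquiv_apply (h.map_vacuum (σ n)) _).symm

theorem IsExchangeableVacuum.exists_actions (h : IsExchangeableVacuum q l ζ U)
    (hU : ∀ σ j, (U σ).conjStarAlgEquiv (a j) = a (σ j)) (ha : ∀ j, a j ∈ cstarGen l) :
    ∃ (αP : IndexAction finitePermutations a) (αL : IndexAction increasingMaps a)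
      (αZ : IndexAction shifts a),
      αP.invariantStates = αL.invariantStates ∧ αL.invariantStates = αZ.invariantStates ∧
      αZ.invariantStates = {vectorFunctional (cstarGen a) ζ} := by
  have hs : shifts ≤ increasingMaps := by
    rintro g ⟨n, hn⟩ i j hij
    rw [hn, hn]
    exact add_lt_add_left hij n
  have hi : ∀ g ∈ increasingMaps, Function.Injective g := fun g hg => StrictMono.injective hg
  obtain ⟨αP, hP⟩ := h.exists_invariantStates_eq hU ha finitePermutations
    (fun g hg => hg.1.injective) (.inl le_rfl)
  obtain ⟨αL, hL⟩ := h.exists_invariantStates_eq hU ha increasingMaps hi (.inr hs)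
  obtain ⟨αZ, hZ⟩ := h.exists_invariantStates_eq hU ha shifts
    (fun g hg => hi g (hs hg)) (.inr le_rfl)
  exact ⟨αP, αL, αZ, hP.trans hL.symm, hL.trans hZ.symm, hZ⟩

end Action

/-! ### The `q`-annihilators over `ℓ²(ℤ)` as an instance of the abstract setting. -/

section EllTwo

/-- The unitary operator on the `q`-Fock space that implements a permutation of the indices. -/
def permuteFock (q : Set.Ioo (-1 : ℝ) 1) (σ : Equiv.Perm ℤ) : Fock q EllTwo ≃ₗᵢ[ℂ] Fock q EllTwo :=
  secondQuantization q (permuteBasis σ)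

theorem conjStarAlgEquiv_eq {F : Type*} [NormedAddCommGroup F] [InnerProductSpace ℂ F]
    [CompleteSpace F] {V : F ≃ₗᵢ[ℂ] F} {a b : F →L[ℂ] F} (h : ∀ x, V (a x) = b (V x)) :
    V.conjStarAlgEquiv a = b := by
  ext x
  rw [LinearIsometryEquiv.conjStarAlgEquiv_apply_apply, h, LinearIsometryEquiv.apply_symm_apply]

theorem star_eq_of_inner {F : Type*} [NormedAddCommGroup F] [InnerProductSpace ℂ F]
    [CompleteSpace F] {a b : F →L[ℂ] F} (h : ∀ x y, inner ℂ (b x) y = inner ℂ x (a y)) :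
    star a = b := by
  ext x
  exact ext_inner_right ℂ fun y => by rw [inner_star_apply, h]

theorem star_l (q : Set.Ioo (-1 : ℝ) 1) (j : ℤ) : star (l q j) = creator q (e j) :=
  star_eq_of_inner (inner_creator_left q (e j))

theorem conj_l (q : Set.Ioo (-1 : ℝ) 1) (σ : Equiv.Perm ℤ) (j : ℤ) :
    (permuteFock q σ).conjStarAlgEquiv (l q j) = l q (σ j) :=
  conjStarAlgEquiv_eq fun x => by
    rw [l, l, permuteFock, secondQuantization_annihilator, permuteBasis_e]

theorem conj_s (q : Set.Ioo (-1 : ℝ) 1) (σ : Equiv.Perm ℤ) (j : ℤ) :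
    (permuteFock q σ).conjStarAlgEquiv (s q j) = s q (σ j) :=
  conjStarAlgEquiv_eq fun x => by
    rw [s, s, permuteFock, add_apply, add_apply, map_add, secondQuantization_annihilator,
      secondQuantization_creator, permuteBasis_e]

theorem isExchangeableVacuum_l (q : Set.Ioo (-1 : ℝ) 1) :
    IsExchangeableVacuum (q : ℝ) (l q) (vacuum q EllTwo) (permuteFock q) where
  abs_lt_one := abs_lt_one q
  mul_star i j := by
    rw [star_l, ← inner_e]
    exact ContinuousLinearMap.ext fun x => annihilator_creator q (e i) (e j) x
  apply_vacuum j := annihilator_vacuum q (e j)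
  norm_vacuum := norm_vacuum q
  map_vacuum _ := secondQuantization_vacuum q _
  conj := conj_l q

/-- This places `𝔖_q` inside `𝔑_q`, so the convergence of means is inherited without Wick ordering
the `s_j`. -/
theorem s_mem_cstarGen (q : Set.Ioo (-1 : ℝ) 1) (j : ℤ) : s q j ∈ cstarGen (l q) := by
  have : s q j = l q j + star (l q j) := by rw [star_l]; rfl
  rw [this]
  exact add_mem (gen (l q) j).2 (star_mem (gen (l q) j).2)

end EllTwo
end QFock
end

theorem mainTheorem5 (q : Set.Ioo (-1 : ℝ) 1) :
    (∃ (αP : QFock.IndexAction QFock.finitePermutations (QFock.l q))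
      (αL : QFock.IndexAction QFock.increasingMaps (QFock.l q))
      (αZ : QFock.IndexAction QFock.shifts (QFock.l q)),
      αP.invariantStates = αL.invariantStates ∧
      αL.invariantStates = αZ.invariantStates ∧
      αZ.invariantStates = {QFock.fockVacuumState q (QFock.l q)}) ∧
    (∃ (βP : QFock.IndexAction QFock.finitePermutations (QFock.s q))
      (βL : QFock.IndexAction QFock.increasingMaps (QFock.s q))
      (βZ : QFock.IndexAction QFock.shifts (QFock.s q)),
      βP.invariantStates = βL.invariantStates ∧
      βL.invariantStates = βZ.invariantStates ∧
      βZ.invariantStates = {QFock.fockVacuumState q (QFock.s q)}) :=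
  ⟨(QFock.isExchangeableVacuum_l q).exists_actions (QFock.conj_l q)
      fun j => (QFock.gen (QFock.l q) j).2,
    (QFock.isExchangeableVacuum_l q).exists_actions (QFock.conj_s q) (QFock.s_mem_cstarGen q)⟩
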